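/- A diffeological vector space is a real vector space with a diffeology for which addition and scalar multiplication are smooth; it is projective if every smooth linear map $P \to W_2$ out of it lifts through every linear subduction $W_1 \to W_2$ of diffeological vector spaces to a smooth linear map $P \to W_1$. For a diffeological group $G$, a principal $G$-bundle over a diffeological space $B$ is a smooth map $\pi : E \to B$ together with a smooth right $G$-action on $E$ preserving the fibres of $\pi$, such that for every plot $p : U \to B$ ($U$ open in some $\mathbb{R}^n$) the pullback $p^*E \to U$ is locally trivial, i.e. $U$ has a $D$-open cover over each member $O$ of which it is $G$-equivariantly diffeomorphic over $O$ to $O \times G$. It is trivial if $E$ is $G$-equivariantly diffeomorphic over $B$ to $B \times G$. A classifying space for principal $G$-bundles is a diffeological space $BG$ with bijections, natural in the diffeological space $X$, between the set $[X, BG]$ of smooth homotopy classes of smooth maps $X \to BG$ and the set of isomorphism classes of principal $G$-bundles over $X$. **Theorem.** Let $V$ be a diffeological vector space that is not projective. Then $V$ is smoothly contractible (its identity map is smoothly homotopic to a constant map), and there is a diffeological vector space $W$ such that 1. there is a non-trivial principal $W$-bundle over $V$, and 2. there is no classifying space for principal $W$-bundles. -/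

import Mathlib

open Diffeology Topology

universe u v w w'

namespace DiffBundle

/-! ### Sub-diffeologies and product diffeologies

Mathlib records a diffeology by its global plots `EuclideanSpace ℝ (Fin n) → X`. A map `p : U → X`
on an open subset `U` is a plot in the classical sense if and only if it is `DSmooth` for the
sub-diffeology of `U`; this is how plots with domain `U` are expressed below. -/

/-- The diffeology on `X` whose plots are the `p` such that `f ∘ p` is a plot of `Y`. -/
@[reducible]
def pullbackDiffeology {X : Type u} {Y : Type v} [DiffeologicalSpace Y] (f : X → Y) :
    DiffeologicalSpace X where
  plots _ := {p | IsPlot (f ∘ p)}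
  constant_plots x := isPlot_const (x := f x)
  plot_reparam hp hf := isPlot_reparam hp hf
  locality {_ _} h := DiffeologicalSpace.locality fun x => by
    obtain ⟨u, hu, hxu, h'⟩ := h x
    exact ⟨u, hu, hxu, fun hf hf' => h' hf hf'⟩

/-- The sub-diffeology. -/
instance instSubtype {X : Type u} [DiffeologicalSpace X] (P : X → Prop) :
    DiffeologicalSpace (Subtype P) :=
  pullbackDiffeology Subtype.val

/-- The product diffeology. -/
instance instProd {X : Type u} {Y : Type v} [DiffeologicalSpace X] [DiffeologicalSpace Y] :
    DiffeologicalSpace (X × Y) where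
  plots _ := {p | IsPlot (fun x => (p x).1) ∧ IsPlot (fun x => (p x).2)}
  constant_plots x := ⟨isPlot_const (x := x.1), isPlot_const (x := x.2)⟩
  plot_reparam hp hf := ⟨isPlot_reparam hp.1 hf, isPlot_reparam hp.2 hf⟩
  locality {_ _} h :=
    ⟨DiffeologicalSpace.locality fun x => by
      obtain ⟨u, hu, hxu, h'⟩ := h x
      exact ⟨u, hu, hxu, fun hf hf' => (h' hf hf').1⟩,
    DiffeologicalSpace.locality fun x => by
      obtain ⟨u, hu, hxu, h'⟩ := h x
      exact ⟨u, hu, hxu, fun hf hf' => (h' hf hf').2⟩⟩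

section basic

variable {X : Type u} {Y : Type v} {Z : Type w}
  [DiffeologicalSpace X] [DiffeologicalSpace Y] [DiffeologicalSpace Z]

theorem dSmooth_val {P : X → Prop} : DSmooth (Subtype.val : Subtype P → X) := fun _ _ hp => hp

theorem dSmooth_mk {P : X → Prop} {f : Z → X} (hf : DSmooth f) (h : ∀ z, P (f z)) :
    DSmooth (fun z => (⟨f z, h z⟩ : Subtype P)) := fun n p hp => hf n p hp

theorem dSmooth_fst : DSmooth (fun q : X × Y => q.1) := fun _ _ hp => hp.1

theorem dSmooth_snd : DSmooth (fun q : X × Y => q.2) := fun _ _ hp => hp.2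

theorem dSmooth_prodMk {f : Z → X} {g : Z → Y} (hf : DSmooth f) (hg : DSmooth g) :
    DSmooth (fun z => (f z, g z)) := fun n p hp => ⟨hf n p hp, hg n p hp⟩

end basic

/-- A subduction: the plots of `Y` are exactly the maps that lift locally to plots of `X`. -/
def IsSubduction {X : Type u} {Y : Type v} [DiffeologicalSpace X] [DiffeologicalSpace Y]
    (f : X → Y) : Prop :=
  DSmooth f ∧ ∀ (n : ℕ) (p : EuclideanSpace ℝ (Fin n) → Y), IsPlot p →
    ∀ x, ∃ U : Set (EuclideanSpace ℝ (Fin n)), IsOpen U ∧ x ∈ U ∧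
      ∃ q : U → X, DSmooth q ∧ ∀ z : U, f (q z) = p z

/-! ### Smooth homotopy -/

/-- Smooth maps between diffeological spaces. -/
def SmoothMap (X : Type u) (Y : Type v) [DiffeologicalSpace X] [DiffeologicalSpace Y] :
    Type (max u v) :=
  {f : X → Y // DSmooth f}

/-- Two smooth maps are smoothly homotopic. -/
def SmoothlyHomotopic {X : Type u} {Y : Type v} [DiffeologicalSpace X] [DiffeologicalSpace Y]
    (f g : SmoothMap X Y) : Prop :=
  ∃ F : X × ℝ → Y, DSmooth F ∧ (∀ x, F (x, 0) = f.1 x) ∧ ∀ x, F (x, 1) = g.1 x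

/-- A space is smoothly contractible if its identity is smoothly homotopic to a constant map. -/
def SmoothlyContractible (X : Type u) [DiffeologicalSpace X] : Prop :=
  ∃ x₀ : X, SmoothlyHomotopic (⟨fun x => x, dSmooth_id'⟩ : SmoothMap X X)
    ⟨fun _ => x₀, dSmooth_const⟩

/-- The set `[X, Y]` of smooth homotopy classes of smooth maps. (Smooth homotopy is an equivalence
relation, so that passing to the generated equivalence relation in `Quot` changes nothing.) -/
def HomotopyClasses (X : Type u) (Y : Type v) [DiffeologicalSpace X] [DiffeologicalSpace Y] :
    Type (max u v) :=
  Quot (SmoothlyHomotopic (X := X) (Y := Y))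

/-- Precomposition `[Y, Z] → [X, Z]` with a smooth map `X → Y`. -/
def HomotopyClasses.precomp {X : Type u} {Y : Type v} {Z : Type w} [DiffeologicalSpace X]
    [DiffeologicalSpace Y] [DiffeologicalSpace Z] (f : SmoothMap X Y) :
    HomotopyClasses Y Z → HomotopyClasses X Z :=
  Quot.map (fun g => (⟨fun x => g.1 (f.1 x), g.2.comp f.2⟩ : SmoothMap X Z)) <| by
    rintro g g' ⟨F, hF, h0, h1⟩
    exact ⟨fun q => F (f.1 q.1, q.2),
      hF.comp (dSmooth_prodMk (f.2.comp dSmooth_fst) dSmooth_snd),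
      fun x => h0 _, fun x => h1 _⟩

/-! ### Diffeological groups and diffeological vector spaces -/

/-- A diffeological group, written additively (and not assumed commutative). -/
class DiffeologicalAddGroup (G : Type u) [AddGroup G] [DiffeologicalSpace G] : Prop where
  smooth_add : DSmooth (fun q : G × G => q.1 + q.2)
  smooth_neg : DSmooth (fun g : G => -g)

/-- A diffeological vector space. -/
class DiffeologicalVectorSpace (V : Type u) [AddCommGroup V] [Module ℝ V]
    [DiffeologicalSpace V] : Prop where
  smooth_add : DSmooth (fun q : V × V => q.1 + q.2)
  smooth_smul : DSmooth (fun q : ℝ × V => q.1 • q.2)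

instance instAddGroupOfVectorSpace (V : Type u) [AddCommGroup V] [Module ℝ V]
    [DiffeologicalSpace V] [DiffeologicalVectorSpace V] : DiffeologicalAddGroup V where
  smooth_add := DiffeologicalVectorSpace.smooth_add
  smooth_neg := by
    have h : DSmooth (fun v : V => (-1 : ℝ) • v) :=
      (DiffeologicalVectorSpace.smooth_smul (V := V)).comp
        (dSmooth_prodMk (dSmooth_const (y := (-1 : ℝ))) dSmooth_id')
    simpa using h

/-- Projectivity of a diffeological vector space: smooth linear maps out of it lift along linear
subductions. -/
def IsProjective (P : Type u) [AddCommGroup P] [Module ℝ P] [DiffeologicalSpace P] : Prop :=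
  ∀ (W₁ W₂ : Type u) [AddCommGroup W₁] [Module ℝ W₁] [DiffeologicalSpace W₁]
    [DiffeologicalVectorSpace W₁] [AddCommGroup W₂] [Module ℝ W₂] [DiffeologicalSpace W₂]
    [DiffeologicalVectorSpace W₂] (π : W₁ →ₗ[ℝ] W₂) (f : P →ₗ[ℝ] W₂),
    IsSubduction π → DSmooth f → ∃ g : P →ₗ[ℝ] W₁, DSmooth g ∧ ∀ x, π (g x) = f x

/-! ### Principal bundles -/

/-- A smooth map `proj : E → B` together with a smooth right action of `G` on `E` that preserves
the fibres of `proj`. -/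
structure GSpaceOver (G : Type u) (B : Type v) [AddGroup G] [DiffeologicalSpace G]
    [DiffeologicalSpace B] : Type (max u v (w + 1)) where
  E : Type w
  [diffeology : DiffeologicalSpace E]
  proj : E → B
  smooth_proj : DSmooth proj
  act : E → G → E
  act_zero : ∀ e, act e 0 = e
  act_add : ∀ e g h, act e (g + h) = act (act e g) h
  smooth_act : DSmooth (fun q : E × G => act q.1 q.2)
  proj_act : ∀ e g, proj (act e g) = proj e

attribute [instance] GSpaceOver.diffeology

namespace GSpaceOver

section

variable {G : Type u} {B : Type v} [AddGroup G] [DiffeologicalSpace G] [DiffeologicalSpace B]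

/-- `E` is a trivial principal `G`-bundle: it is `G`-equivariantly diffeomorphic to `B × G` over
`B`. -/
def IsTrivial (E : GSpaceOver.{u, v, w} G B) : Prop :=
  ∃ h : E.E ≃ B × G, DSmooth h ∧ DSmooth h.symm ∧ (∀ e, (h e).1 = E.proj e) ∧
    ∀ e g, h (E.act e g) = ((h e).1, (h e).2 + g)

/-- `G`-equivariant diffeomorphism over the base. -/
def Iso (E : GSpaceOver.{u, v, w} G B) (E' : GSpaceOver.{u, v, w'} G B) : Prop :=
  ∃ h : E.E ≃ E'.E, DSmooth h ∧ DSmooth h.symm ∧ (∀ e, E'.proj (h e) = E.proj e) ∧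
    ∀ e g, h (E.act e g) = E'.act (h e) g

/-- The restriction of `E` to a subset `O` of the base. -/
def restrict (E : GSpaceOver.{u, v, w} G B) (O : Set B) : GSpaceOver.{u, v, w} G O where
  E := {e : E.E // E.proj e ∈ O}
  proj e := ⟨E.proj e.1, e.2⟩
  smooth_proj := dSmooth_mk (E.smooth_proj.comp dSmooth_val) _
  act e g := ⟨E.act e.1 g, by rw [E.proj_act]; exact e.2⟩
  act_zero e := Subtype.ext (E.act_zero _)
  act_add e g h := Subtype.ext (E.act_add _ _ _)
  smooth_act := dSmooth_mk (f := fun q : {e : E.E // E.proj e ∈ O} × G => E.act q.1.1 q.2)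
    (E.smooth_act.comp (dSmooth_prodMk (dSmooth_val.comp dSmooth_fst) dSmooth_snd)) _
  proj_act e g := Subtype.ext (E.proj_act _ _)

/-- The pullback of `E` along a smooth map `f : B' → B`. -/
def pullback (E : GSpaceOver.{u, v, w} G B) {B' : Type w'} [DiffeologicalSpace B']
    (f : SmoothMap B' B) : GSpaceOver.{u, w', max w w'} G B' where
  E := {q : B' × E.E // f.1 q.1 = E.proj q.2}
  proj q := q.1.1
  smooth_proj := dSmooth_fst.comp dSmooth_val
  act q g := ⟨(q.1.1, E.act q.1.2 g), by rw [E.proj_act]; exact q.2⟩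
  act_zero q := Subtype.ext (Prod.ext rfl (E.act_zero _))
  act_add q g h := Subtype.ext (Prod.ext rfl (E.act_add _ _ _))
  smooth_act := dSmooth_mk
    (f := fun q : {q : B' × E.E // f.1 q.1 = E.proj q.2} × G => (q.1.1.1, E.act q.1.1.2 q.2))
    (dSmooth_prodMk (dSmooth_fst.comp (dSmooth_val.comp dSmooth_fst))
      (E.smooth_act.comp
        (dSmooth_prodMk (dSmooth_snd.comp (dSmooth_val.comp dSmooth_fst)) dSmooth_snd))) _
  proj_act _ _ := rfl

/-- `E` is a locally trivial principal `G`-bundle: the base has a `D`-open cover by sets over which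
`E` is trivial. -/
def IsLocallyTrivial (E : GSpaceOver.{u, v, w} G B) : Prop :=
  ∀ b : B, ∃ O : Set B, IsOpen[dTopology] O ∧ b ∈ O ∧ (E.restrict O).IsTrivial

/-- `E` is a (diffeological) principal `G`-bundle: its pullback along every plot `U → B`, with `U`
open in some `ℝⁿ`, is locally trivial. -/
def IsPrincipal (E : GSpaceOver.{u, v, w} G B) : Prop :=
  ∀ (n : ℕ) (U : Set (EuclideanSpace ℝ (Fin n))), IsOpen U →
    ∀ p : SmoothMap U B, (E.pullback p).IsLocallyTrivial

theorem Iso.refl (E : GSpaceOver.{u, v, w} G B) : E.Iso E :=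
  ⟨Equiv.refl _, dSmooth_id', dSmooth_id', fun _ => rfl, fun _ _ => rfl⟩

theorem Iso.symm {E : GSpaceOver.{u, v, w} G B} {E' : GSpaceOver.{u, v, w'} G B}
    (h : E.Iso E') : E'.Iso E := by
  obtain ⟨h, h1, h2, h3, h4⟩ := h
  refine ⟨h.symm, h2, h1, fun e => ?_, fun e g => ?_⟩
  · rw [← h3, h.apply_symm_apply]
  · rw [h.symm_apply_eq, h4, h.apply_symm_apply]

theorem Iso.trans {E E' E'' : GSpaceOver.{u, v, w} G B}
    (h : E.Iso E') (k : E'.Iso E'') : E.Iso E'' := by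
  obtain ⟨h, h1, h2, h3, h4⟩ := h
  obtain ⟨k, k1, k2, k3, k4⟩ := k
  refine ⟨h.trans k, k1.comp h1, h2.comp k2, fun e => ?_, fun e g => ?_⟩
  · simp [h3, k3]
  · simp [h4, k4]

theorem IsTrivial.of_iso {E : GSpaceOver.{u, v, w} G B} {E' : GSpaceOver.{u, v, w'} G B}
    (h : E.Iso E') (k : E'.IsTrivial) : E.IsTrivial := by
  obtain ⟨h, h1, h2, h3, h4⟩ := h
  obtain ⟨k, k1, k2, k3, k4⟩ := k
  refine ⟨h.trans k, k1.comp h1, h2.comp k2, fun e => ?_, fun e g => ?_⟩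
  · simp [h3, k3]
  · simp [h4, k4]

theorem Iso.restrict {E : GSpaceOver.{u, v, w} G B} {E' : GSpaceOver.{u, v, w'} G B}
    (h : E.Iso E') (O : Set B) : (E.restrict O).Iso (E'.restrict O) := by
  obtain ⟨h, h1, h2, h3, h4⟩ := h
  refine ⟨h.subtypeEquiv fun e => by rw [h3], ?_, ?_, fun e => Subtype.ext (h3 _),
    fun e g => Subtype.ext (h4 _ _)⟩
  · exact dSmooth_mk (h1.comp dSmooth_val) _
  · exact dSmooth_mk (h2.comp dSmooth_val) _

theorem IsLocallyTrivial.of_iso {E : GSpaceOver.{u, v, w} G B} {E' : GSpaceOver.{u, v, w'} G B}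
    (h : E.Iso E') (k : E'.IsLocallyTrivial) : E.IsLocallyTrivial := fun b => by
  obtain ⟨O, hO, hb, ht⟩ := k b
  exact ⟨O, hO, hb, ht.of_iso (h.restrict O)⟩

theorem Iso.pullback {E : GSpaceOver.{u, v, w} G B} {E' : GSpaceOver.{u, v, w} G B}
    (h : E.Iso E') {B' : Type w'} [DiffeologicalSpace B'] (f : SmoothMap B' B) :
    (E.pullback f).Iso (E'.pullback f) := by
  obtain ⟨h, h1, h2, h3, h4⟩ := h
  refine ⟨((Equiv.refl B').prodCongr h).subtypeEquiv fun q => by simp [h3], ?_, ?_,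
    fun _ => rfl, fun e g => Subtype.ext (Prod.ext rfl (h4 _ _))⟩
  · exact dSmooth_mk (f := fun q : {q : B' × E.E // f.1 q.1 = E.proj q.2} => (q.1.1, h q.1.2))
      (dSmooth_prodMk (dSmooth_fst.comp dSmooth_val) (h1.comp (dSmooth_snd.comp dSmooth_val))) _
  · exact dSmooth_mk
      (f := fun q : {q : B' × E'.E // f.1 q.1 = E'.proj q.2} => (q.1.1, h.symm q.1.2))
      (dSmooth_prodMk (dSmooth_fst.comp dSmooth_val) (h2.comp (dSmooth_snd.comp dSmooth_val))) _

/-- Transitivity of pullbacks. -/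
theorem pullback_pullback_iso (E : GSpaceOver.{u, v, w} G B) {B' : Type w'} [DiffeologicalSpace B']
    (f : SmoothMap B' B) {U : Type} [DiffeologicalSpace U] (p : SmoothMap U B') :
    ((E.pullback f).pullback p).Iso
      (E.pullback (⟨fun x => f.1 (p.1 x), f.2.comp p.2⟩ : SmoothMap U B)) := by
  let toF : ((E.pullback f).pullback p).E →
      (E.pullback (⟨fun x => f.1 (p.1 x), f.2.comp p.2⟩ : SmoothMap U B)).E :=
    fun q => ⟨(q.1.1, q.1.2.1.2), (congrArg f.1 q.2).trans q.1.2.2⟩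
  let invF : (E.pullback (⟨fun x => f.1 (p.1 x), f.2.comp p.2⟩ : SmoothMap U B)).E →
      ((E.pullback f).pullback p).E :=
    fun q => ⟨(q.1.1, ⟨(p.1 q.1.1, q.1.2), q.2⟩), rfl⟩
  refine ⟨⟨toF, invF, ?_, fun _ => rfl⟩, ?_, ?_, fun _ => rfl, fun _ _ => rfl⟩
  · rintro ⟨⟨x, ⟨⟨b, e⟩, hbe⟩⟩, hx⟩
    have hx' : p.1 x = b := hx
    subst hx'
    rfl
  · exact fun n q hq => ⟨hq.1, hq.2.2⟩
  · exact fun n q hq => ⟨hq.1, p.2 n _ hq.1, hq.2⟩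

theorem IsPrincipal.pullback {E : GSpaceOver.{u, v, w} G B} (hE : E.IsPrincipal) {B' : Type w'}
    [DiffeologicalSpace B'] (f : SmoothMap B' B) : (E.pullback f).IsPrincipal :=
  fun n U hU p => (hE n U hU ⟨fun x => f.1 (p.1 x), f.2.comp p.2⟩).of_iso
    (E.pullback_pullback_iso f p)

end

end GSpaceOver

/-- Principal `G`-bundles over `B`. -/
def PrincipalBundle (G B : Type u) [AddGroup G] [DiffeologicalSpace G] [DiffeologicalSpace B] :
    Type (u + 1) :=
  {E : GSpaceOver.{u, u, u} G B // E.IsPrincipal}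

/-- Isomorphism of principal `G`-bundles over `B`. -/
instance isoSetoid (G B : Type u) [AddGroup G] [DiffeologicalSpace G] [DiffeologicalSpace B] :
    Setoid (PrincipalBundle G B) where
  r E E' := E.1.Iso E'.1
  iseqv := ⟨fun E => .refl E.1, fun h => h.symm, fun h k => h.trans k⟩

/-- The set of isomorphism classes of principal `G`-bundles over `B`. -/
def Prin (G B : Type u) [AddGroup G] [DiffeologicalSpace G] [DiffeologicalSpace B] :
    Type (u + 1) :=
  Quotient (isoSetoid G B)

/-- Pullback of isomorphism classes of principal bundles along a smooth map. -/
def Prin.pullback {G B B' : Type u} [AddGroup G] [DiffeologicalSpace G] [DiffeologicalSpace B]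
    [DiffeologicalSpace B'] (f : SmoothMap B' B) : Prin G B → Prin G B' :=
  Quotient.map (fun E => (⟨E.1.pullback f, E.2.pullback f⟩ : PrincipalBundle G B'))
    fun _ _ h => GSpaceOver.Iso.pullback h f

/-- `BG` is a classifying space for principal `G`-bundles: there are bijections between `[X, BG]`
and the set of isomorphism classes of principal `G`-bundles over `X`, for all diffeological spaces
`X`, natural in `X`. -/
def IsClassifyingSpace (G : Type u) [AddGroup G] [DiffeologicalSpace G] [DiffeologicalAddGroup G]
    (BG : Type u) [DiffeologicalSpace BG] : Prop :=
  ∃ θ : ∀ (X : Type u) [DiffeologicalSpace X], HomotopyClasses X BG ≃ Prin G X,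
    ∀ (X Y : Type u) [DiffeologicalSpace X] [DiffeologicalSpace Y] (f : SmoothMap X Y)
      (c : HomotopyClasses Y BG), θ X (c.precomp f) = (θ Y c).pullback f

end DiffBundle

open scoped ContDiff

namespace DiffBundle

/-! ### Smooth families in diffeological vector spaces -/

section families

variable {Y : Type*} [DiffeologicalSpace Y]

/-! Let `p` evaluate all plots of `V` on the disjoint union of their domains, the nebula. Over `v`
put the finite combinations `ξ` of points of the nebula with `p_* ξ = δ_v`; this is an affine space
over `W = ker p_*`. The resulting bundle over `V` is principal, since a plot lifts tautologically to
the nebula. It has a smooth section `s` if it is trivial, and the point is that such a section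
forces `V` to be projective.

Composing `s` with smooth functions on the nebula gives smooth functions on `V` that separate each
`v ≠ 0` from `0`. Their directional derivatives are smooth linear functionals that do the same
(`exists_smooth_functional`).

Next, every plot `q` lies locally in a finite-dimensional subspace. Near `(0, a)`, `s (t • q y)` is
a sum of a fixed number of smooth terms, so some term supplies a curve `z` in the nebula with `p (z
t) = t • q y` for arbitrarily small `t`, carrying a coefficient bounded below. The starting points
`z 0` of such curves are isolated (`eventually_eq_of_frequently_large`), so near `a` only finitely
many occur. Differentiating at `t = 0` shows that `q y` is seen by all smooth functionals as a
derivative of `p` at one of these points; such vectors span a finite-dimensional space.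

Isolation is a first-order argument. The variation of `s (t • p x)` in `x` is `t` times that of `s`
along an unscaled curve, so it vanishes as `t → 0` (`exists_rep_norm_le`). Terms that follow `x`
itself with nonzero total weight on an accumulating set of points would contradict this.

With both properties, any linear section of a linear subduction is smooth along smooth linear maps
out of `V`, so `V` is projective. Finally, `V` is contractible, so a classifying space would make
each bundle over `V` isomorphic to its pullback along a constant map, which is trivial here. -/

theorem isPlot_of_locally {n : ℕ} {p : EuclideanSpace ℝ (Fin n) → Y}
    (h : ∀ a, ∃ q : EuclideanSpace ℝ (Fin n) → Y, IsPlot q ∧ p =ᶠ[𝓝 a] q) : IsPlot p := by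
  refine DiffeologicalSpace.locality fun a => ?_
  obtain ⟨q, hq, hpq⟩ := h a
  obtain ⟨u, hu, huo, hau⟩ := eventually_nhds_iff.1 hpq
  refine ⟨u, huo, hau, fun {_ f} hf hfs => ?_⟩
  have : p ∘ f = q ∘ f := funext fun x => hu _ (hf x)
  rw [this]
  exact isPlot_reparam hq hfs

/-- A map from a normed space to a diffeological space which pulls back to plots. -/
def SmoothFamily {E : Type*} [NormedAddCommGroup E] [NormedSpace ℝ E] (q : E → Y) : Prop :=
  ∀ (m : ℕ) (g : EuclideanSpace ℝ (Fin m) → E), ContDiff ℝ ∞ g → IsPlot (fun x => q (g x))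

variable {E E' : Type*} [NormedAddCommGroup E] [NormedSpace ℝ E] [NormedAddCommGroup E']
  [NormedSpace ℝ E']

theorem SmoothFamily.comp {q : E → Y} (hq : SmoothFamily q) {g : E' → E} (hg : ContDiff ℝ ∞ g) :
    SmoothFamily (fun x => q (g x)) := fun m _ hf => hq m _ (hg.comp hf)

theorem SmoothFamily.dSmooth {Z : Type*} [DiffeologicalSpace Z] {q : E → Y} (hq : SmoothFamily q)
    {f : Y → Z} (hf : DSmooth f) : SmoothFamily (fun x => f (q x)) :=
  fun m g hg => hf _ _ (hq m g hg)

theorem smoothFamily_of_isPlot {n : ℕ} {p : EuclideanSpace ℝ (Fin n) → Y} (hp : IsPlot p) :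
    SmoothFamily p := fun _ _ hg => isPlot_reparam hp hg

theorem SmoothFamily.const (y : Y) : SmoothFamily (fun _ : E => y) := fun _ _ _ => isPlot_const

theorem SmoothFamily.contDiff [FiniteDimensional ℝ E] {q : E → ℝ} (hq : SmoothFamily q) :
    ContDiff ℝ ∞ q := by
  have h : ContDiff ℝ ∞ (fun x => q ((toEuclidean (E := E)).symm x)) :=
    (hq _ _ (toEuclidean (E := E)).symm.contDiff).contDiff
  simpa [Function.comp_def] using h.comp (toEuclidean (E := E)).contDiff

end families

section vector

variable {V : Type*} [AddCommGroup V] [Module ℝ V] [DiffeologicalSpace V]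
  [DiffeologicalVectorSpace V]
variable {E : Type*} [NormedAddCommGroup E] [NormedSpace ℝ E]

theorem isPlot_add {n : ℕ} {p q : EuclideanSpace ℝ (Fin n) → V} (hp : IsPlot p) (hq : IsPlot q) :
    IsPlot (fun x => p x + q x) :=
  DiffeologicalVectorSpace.smooth_add n (fun x => (p x, q x)) ⟨hp, hq⟩

theorem isPlot_smul {n : ℕ} {c : EuclideanSpace ℝ (Fin n) → ℝ} {q : EuclideanSpace ℝ (Fin n) → V}
    (hc : IsPlot c) (hq : IsPlot q) : IsPlot (fun x => c x • q x) :=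
  DiffeologicalVectorSpace.smooth_smul n (fun x => (c x, q x)) ⟨hc, hq⟩

theorem isPlot_sum {n : ℕ} {ι : Type*} (s : Finset ι) {p : ι → EuclideanSpace ℝ (Fin n) → V}
    (hp : ∀ i, IsPlot (p i)) : IsPlot (fun x => ∑ i ∈ s, p i x) := by
  classical
  induction s using Finset.induction_on with
  | empty => simpa using isPlot_const (x := (0 : V))
  | insert a s ha ih =>
    simp only [Finset.sum_insert ha]
    exact isPlot_add (hp a) ih

theorem SmoothFamily.add {p q : E → V} (hp : SmoothFamily p) (hq : SmoothFamily q) :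
    SmoothFamily (fun x => p x + q x) := fun m g hg => isPlot_add (hp m g hg) (hq m g hg)

theorem SmoothFamily.smul {c : E → ℝ} {q : E → V} (hc : ContDiff ℝ ∞ c) (hq : SmoothFamily q) :
    SmoothFamily (fun x => c x • q x) :=
  fun m g hg => isPlot_smul (hc.comp hg).isPlot (hq m g hg)

theorem SmoothFamily.sub {p q : E → V} (hp : SmoothFamily p) (hq : SmoothFamily q) :
    SmoothFamily (fun x => p x - q x) := by
  have := hp.add (SmoothFamily.smul (c := fun _ => (-1 : ℝ)) contDiff_const hq)
  simpa [sub_eq_add_neg] using this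

theorem smoothFamily_smul_const (v : V) : SmoothFamily (fun t : ℝ => t • v) :=
  SmoothFamily.smul contDiff_id (SmoothFamily.const v)

/-! ### Directional derivatives of smooth functions -/

/-- The partial derivatives of a smooth family at the origin add up to the diagonal one. -/
theorem deriv_diag {K : ℝ × ℝ → ℝ} (hK : ContDiff ℝ ∞ K) :
    deriv (fun t => K (t, t)) 0 = deriv (fun t => K (t, 0)) 0 + deriv (fun t => K (0, t)) 0 := by
  have hd : HasFDerivAt K (fderiv ℝ K (0, 0)) (0, 0) :=
    (hK.differentiable (by simp) _).hasFDerivAt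
  have h1 : HasDerivAt (fun t => K (t, t)) (fderiv ℝ K (0, 0) (1, 1)) 0 :=
    HasFDerivAt.comp_hasDerivAt (x := (0 : ℝ)) (f := fun t : ℝ => (t, t)) (l := K) hd
      ((hasDerivAt_id 0).prodMk (hasDerivAt_id 0))
  have h2 : HasDerivAt (fun t => K (t, 0)) (fderiv ℝ K (0, 0) (1, 0)) 0 :=
    HasFDerivAt.comp_hasDerivAt (x := (0 : ℝ)) (f := fun t : ℝ => (t, (0 : ℝ))) (l := K) hd
      ((hasDerivAt_id 0).prodMk (hasDerivAt_const 0 0))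
  have h3 : HasDerivAt (fun t => K (0, t)) (fderiv ℝ K (0, 0) (0, 1)) 0 :=
    HasFDerivAt.comp_hasDerivAt (x := (0 : ℝ)) (f := fun t : ℝ => ((0 : ℝ), t)) (l := K) hd
      ((hasDerivAt_const 0 0).prodMk (hasDerivAt_id 0))
  rw [h1.deriv, h2.deriv, h3.deriv, ← map_add]
  simp

theorem deriv_snd_eq_fderiv {E : Type*} [NormedAddCommGroup E] [NormedSpace ℝ E]
    {K : E × ℝ → ℝ} (hK : ContDiff ℝ ∞ K) (a : E) :
    deriv (fun t => K (a, t)) 0 = fderiv ℝ K (a, 0) (0, 1) := by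
  have hd : HasFDerivAt K (fderiv ℝ K (a, 0)) (a, 0) :=
    (hK.differentiable (by simp) _).hasFDerivAt
  exact (HasFDerivAt.comp_hasDerivAt (x := (0 : ℝ)) (f := fun t : ℝ => (a, t)) (l := K) hd
      ((hasDerivAt_const 0 a).prodMk (hasDerivAt_id 0))).deriv

theorem contDiff_deriv_snd {E : Type*} [NormedAddCommGroup E] [NormedSpace ℝ E]
    {K : E × ℝ → ℝ} (hK : ContDiff ℝ ∞ K) :
    ContDiff ℝ ∞ (fun a => deriv (fun t => K (a, t)) 0) := by
  simp only [deriv_snd_eq_fderiv hK]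
  exact ((hK.fderiv_right (m := ∞) (by simp)).comp
    (contDiff_id.prodMk contDiff_const)).clm_apply contDiff_const

/-- The derivative of a smooth function along a smooth curve through the origin scales linearly. -/
theorem deriv_smul_curve {f : V → ℝ} (hf : DSmooth f) (a : V) {g : ℝ → V} (hg : SmoothFamily g)
    (g0 : g 0 = 0) (c : ℝ) :
    deriv (fun t => f (a + c • g t)) 0 = c * deriv (fun t => f (a + g t)) 0 := by
  -- No chain rule is available in `V` itself. The derivative is additive in `c` by `deriv_diag` and
  -- continuous in `c`, hence linear.
  have hcont : Continuous (fun c : ℝ => deriv (fun t => f (a + c • g t)) 0) := by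
    have hK : ContDiff ℝ ∞ (fun q : ℝ × ℝ => f (a + q.1 • g q.2)) :=
      (((SmoothFamily.const a).add
        (SmoothFamily.smul contDiff_fst (hg.comp contDiff_snd))).dSmooth hf).contDiff
    exact (contDiff_deriv_snd hK).continuous
  let G : ℝ →+ ℝ := AddMonoidHom.mk' (fun c : ℝ => deriv (fun t => f (a + c • g t)) 0) <| by
    intro c d
    have hK : ContDiff ℝ ∞ (fun q : ℝ × ℝ => f (a + (c • g q.1 + d • g q.2))) :=
      (((SmoothFamily.const a).add
        ((SmoothFamily.smul contDiff_const (hg.comp contDiff_fst)).add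
        (SmoothFamily.smul contDiff_const (hg.comp contDiff_snd)))).dSmooth hf).contDiff
    simpa [g0, add_smul] using deriv_diag hK
  have := map_real_smul G hcont c 1
  simpa [G] using this

/-- If smooth functions separate a vector from zero, then so do smooth linear functionals. -/
theorem exists_smooth_functional {f : V → ℝ} (hf : DSmooth f) {v : V} (hv : f v ≠ f 0) :
    ∃ l : V →ₗ[ℝ] ℝ, DSmooth l ∧ l v ≠ 0 := by
  have hs : ContDiff ℝ ∞ (fun t : ℝ => f (t • v)) :=
    ((smoothFamily_smul_const v).dSmooth hf).contDiff
  -- The base point of the differentiation must move along the ray: the derivative at the origin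
  -- itself may vanish.
  obtain ⟨t₀, ht₀⟩ : ∃ t₀, deriv (fun t : ℝ => f (t • v)) t₀ ≠ 0 := by
    by_contra! h
    have := is_const_of_deriv_eq_zero (hs.differentiable (by simp)) h 1 0
    simp at this
    exact hv this
  let l : V →ₗ[ℝ] ℝ :=
    { toFun := fun w => deriv (fun t : ℝ => f (t₀ • v + t • w)) 0
      map_add' := fun w w' => by
        have hK : ContDiff ℝ ∞ (fun q : ℝ × ℝ => f (t₀ • v + (q.1 • w + q.2 • w'))) :=
          (((SmoothFamily.const _).add
            (((smoothFamily_smul_const w).comp contDiff_fst).add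
            ((smoothFamily_smul_const w').comp contDiff_snd))).dSmooth hf).contDiff
        simpa [smul_add] using deriv_diag hK
      map_smul' := fun c w => by
        have := deriv_smul_curve hf (t₀ • v) (smoothFamily_smul_const w) (by simp) c
        simpa [smul_smul, mul_comm] using this }
  refine ⟨l, fun n p hp => ?_, ?_⟩
  · have hK : ContDiff ℝ ∞ (fun q : EuclideanSpace ℝ (Fin n) × ℝ => f (t₀ • v + q.2 • p q.1)) :=
      (((SmoothFamily.const _).add
        (SmoothFamily.smul contDiff_snd
          ((smoothFamily_of_isPlot hp).comp contDiff_fst))).dSmooth hf).contDiff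
    exact (contDiff_deriv_snd hK).isPlot
  · have h : (fun t : ℝ => f (t₀ • v + t • v)) =
        fun t : ℝ => (fun t : ℝ => f (t • v)) (t₀ + t) := by
      funext t; simp [add_smul]
    change deriv (fun t : ℝ => f (t₀ • v + t • v)) 0 ≠ 0
    rw [h, deriv_comp_const_add (f := fun t : ℝ => f (t • v))]
    simpa using ht₀

end vector

/-! ### Disjoint unions of Euclidean spaces -/

/-- Near a point, the identity agrees with a smooth map whose values stay near this point. -/
theorem exists_contDiff_eventuallyEq_id {E : Type*} [NormedAddCommGroup E] [NormedSpace ℝ E]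
    [FiniteDimensional ℝ E] {x : E} {s : Set E} (hs : s ∈ 𝓝 x) :
    ∃ ρ : E → E, ContDiff ℝ ∞ ρ ∧ (∀ y, ρ y ∈ s) ∧ ∀ᶠ y in 𝓝 x, ρ y = y := by
  obtain ⟨ε, hε, hεs⟩ := Metric.mem_nhds_iff.1 hs
  let χ : ContDiffBump x := ⟨ε / 3, ε / 2, by positivity, by linarith⟩
  refine ⟨fun y => x + χ y • (y - x), contDiff_const.add
    (χ.contDiff.smul (contDiff_id.sub contDiff_const)), fun y => hεs ?_, ?_⟩
  · by_cases hy : dist y x < ε / 2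
    · rw [Metric.mem_ball, dist_eq_norm, add_sub_cancel_left, norm_smul, Real.norm_eq_abs,
        abs_of_nonneg χ.nonneg]
      rw [dist_eq_norm] at hy
      nlinarith [χ.le_one (x := y), χ.nonneg (x := y), norm_nonneg (y - x)]
    · simp only [χ.zero_of_le_dist (not_lt.1 hy)]
      simpa using hε
  · filter_upwards [Metric.closedBall_mem_nhds x χ.rIn_pos] with y hy
    rw [χ.one_of_mem_closedBall hy]
    simp

/-- The disjoint union of the Euclidean spaces of dimensions `d k`. -/
def Nebula {K : Type u} (d : K → ℕ) : Type u := Σ k, EuclideanSpace ℝ (Fin (d k))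

namespace Nebula

variable {K : Type u} {d : K → ℕ}

instance : TopologicalSpace (Nebula d) :=
  inferInstanceAs (TopologicalSpace (Σ k, EuclideanSpace ℝ (Fin (d k))))

instance : T2Space (Nebula d) :=
  inferInstanceAs (T2Space (Σ k, EuclideanSpace ℝ (Fin (d k))))

/-- The point of the component `k` with coordinates `y`. -/
def mk (k : K) (y : EuclideanSpace ℝ (Fin (d k))) : Nebula d := ⟨k, y⟩

theorem continuous_mk (k : K) : Continuous (mk k : EuclideanSpace ℝ (Fin (d k)) → Nebula d) :=
  continuous_sigmaMk (σ := fun k => EuclideanSpace ℝ (Fin (d k)))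

open Classical in
/-- The coordinates of a point of the component `k`, extended by zero to the other components. -/
noncomputable def coord (k : K) (x : Nebula d) : EuclideanSpace ℝ (Fin (d k)) :=
  if h : x.1 = k then h ▸ x.2 else 0

@[simp]
theorem coord_mk (k : K) (y : EuclideanSpace ℝ (Fin (d k))) : coord k (mk k y) = y := by
  simp [coord, mk]

theorem coord_mk_of_ne {k l : K} (h : l ≠ k) (y : EuclideanSpace ℝ (Fin (d l))) :
    coord k (mk l y) = 0 := by
  simp [coord, mk, h]

/-- The smooth functions on a disjoint union of Euclidean spaces. -/
def SmoothFun (h : Nebula d → ℝ) : Prop := ∀ k, ContDiff ℝ ∞ fun y => h (mk k y)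

variable {E E' : Type*} [NormedAddCommGroup E] [NormedSpace ℝ E] [NormedAddCommGroup E']
  [NormedSpace ℝ E']

/-- The smooth maps from a normed space to a disjoint union of Euclidean spaces. -/
def SmoothMapTo (g : E → Nebula d) : Prop :=
  ∃ (k : K) (γ : E → EuclideanSpace ℝ (Fin (d k))), ContDiff ℝ ∞ γ ∧ g = fun u => mk k (γ u)

namespace SmoothMapTo

theorem comp {g : E → Nebula d} (hg : SmoothMapTo g) {f : E' → E} (hf : ContDiff ℝ ∞ f) :
    SmoothMapTo fun u => g (f u) := by
  obtain ⟨k, γ, hγ, rfl⟩ := hg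
  exact ⟨k, fun u => γ (f u), hγ.comp hf, rfl⟩

theorem continuous {g : E → Nebula d} (hg : SmoothMapTo g) : Continuous g := by
  obtain ⟨k, γ, hγ, rfl⟩ := hg
  exact (continuous_mk k).comp hγ.continuous

theorem contDiff_coord {g : E → Nebula d} (hg : SmoothMapTo g) (k : K) :
    ContDiff ℝ ∞ fun u => coord k (g u) := by
  obtain ⟨l, γ, hγ, rfl⟩ := hg
  by_cases h : l = k
  · subst h
    simpa using hγ
  · simpa [coord_mk_of_ne h] using contDiff_const

theorem contDiff_fun {g : E → Nebula d} (hg : SmoothMapTo g) {h : Nebula d → ℝ}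
    (hh : SmoothFun h) : ContDiff ℝ ∞ fun u => h (g u) := by
  obtain ⟨k, γ, hγ, rfl⟩ := hg
  exact (hh k).comp hγ

theorem const (x : Nebula d) : SmoothMapTo fun _ : E => x :=
  ⟨x.1, fun _ => x.2, contDiff_const, rfl⟩

end SmoothMapTo

theorem mk_coord {k : K} {x : Nebula d} (h : x.1 = k) : mk k (coord k x) = x := by
  obtain ⟨l, y⟩ := x
  obtain rfl : l = k := h
  exact congrArg (mk l) (coord_mk l y)

/-! ### The free vector space on a disjoint union of Euclidean spaces -/

/-- Near `a`, the map `P` is a finite combination of smooth maps with smooth coefficients. -/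
def HasLocalRep (P : E → (Nebula d →₀ ℝ)) (a : E) : Prop :=
  ∃ (N : ℕ) (c : Fin N → E → ℝ) (g : Fin N → E → Nebula d),
    (∀ j, ContDiff ℝ ∞ (c j)) ∧ (∀ j, SmoothMapTo (g j)) ∧
      ∀ᶠ u in 𝓝 a, P u = ∑ j, Finsupp.single (g j u) (c j u)

namespace HasLocalRep

theorem of_fintype {ι : Type*} [Fintype ι] {P : E → (Nebula d →₀ ℝ)} {a : E}
    {c : ι → E → ℝ} {g : ι → E → Nebula d} (hc : ∀ j, ContDiff ℝ ∞ (c j))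
    (hg : ∀ j, SmoothMapTo (g j))
    (h : ∀ᶠ u in 𝓝 a, P u = ∑ j, Finsupp.single (g j u) (c j u)) : HasLocalRep P a := by
  refine ⟨Fintype.card ι, fun j => c ((Fintype.equivFin ι).symm j),
    fun j => g ((Fintype.equivFin ι).symm j), fun _ => hc _, fun _ => hg _, h.mono fun u hu => ?_⟩
  rw [hu]
  exact ((Fintype.equivFin ι).symm.sum_comp fun j => Finsupp.single (g j u) (c j u)).symm

theorem congr {P Q : E → (Nebula d →₀ ℝ)} {a : E} (hP : HasLocalRep P a) (h : Q =ᶠ[𝓝 a] P) :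
    HasLocalRep Q a := by
  obtain ⟨N, c, g, hc, hg, hP⟩ := hP
  exact ⟨N, c, g, hc, hg, by filter_upwards [hP, h] with u h1 h2; rw [h2, h1]⟩

theorem comp {P : E → (Nebula d →₀ ℝ)} {f : E' → E} {a : E'} (hP : HasLocalRep P (f a))
    (hf : ContDiff ℝ ∞ f) : HasLocalRep (fun u => P (f u)) a := by
  obtain ⟨N, c, g, hc, hg, hP⟩ := hP
  exact ⟨N, fun j u => c j (f u), fun j u => g j (f u), fun j => (hc j).comp hf,
    fun j => (hg j).comp hf, hf.continuous.continuousAt.eventually hP⟩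

theorem const (ξ : Nebula d →₀ ℝ) (a : E) : HasLocalRep (fun _ => ξ) a := by
  refine of_fintype (ι := ξ.support) (c := fun x _ => ξ x) (g := fun x _ => x)
    (fun _ => contDiff_const) (fun x => SmoothMapTo.const x.1) (.of_forall fun u => ?_)
  rw [Finset.sum_coe_sort ξ.support fun x => Finsupp.single x (ξ x)]
  exact (Finsupp.sum_single ξ).symm

theorem single {g : E → Nebula d} (hg : SmoothMapTo g) (a : E) :
    HasLocalRep (fun u => Finsupp.single (g u) 1) a :=
  of_fintype (ι := Unit) (c := fun _ _ => 1) (g := fun _ => g) (fun _ => contDiff_const)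
    (fun _ => hg) (.of_forall fun u => by simp)

theorem add {P Q : E → (Nebula d →₀ ℝ)} {a : E} (hP : HasLocalRep P a) (hQ : HasLocalRep Q a) :
    HasLocalRep (fun u => P u + Q u) a := by
  obtain ⟨N, c, g, hc, hg, hP⟩ := hP
  obtain ⟨M, c', g', hc', hg', hQ⟩ := hQ
  refine of_fintype (ι := Fin N ⊕ Fin M) (c := Sum.elim c c') (g := Sum.elim g g')
    (Sum.rec hc hc') (Sum.rec hg hg') ?_
  filter_upwards [hP, hQ] with u h1 h2
  simp [h1, h2]

theorem smul {c₀ : E → ℝ} (hc₀ : ContDiff ℝ ∞ c₀) {P : E → (Nebula d →₀ ℝ)} {a : E}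
    (hP : HasLocalRep P a) : HasLocalRep (fun u => c₀ u • P u) a := by
  obtain ⟨N, c, g, hc, hg, hP⟩ := hP
  refine ⟨N, fun j u => c₀ u * c j u, g, fun j => hc₀.mul (hc j), hg, hP.mono fun u hu => ?_⟩
  simp [hu, Finset.smul_sum]

end HasLocalRep

instance instDiffeologicalSpaceFree : DiffeologicalSpace (Nebula d →₀ ℝ) where
  plots _ := {P | ∀ a, HasLocalRep P a}
  constant_plots ξ := HasLocalRep.const ξ
  plot_reparam hp hf a := (hp _).comp hf
  -- The locality hypothesis only concerns maps into `s`, so the identity is replaced by a globally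
  -- smooth map into `s` that agrees with it near `a`.
  locality {n P} hP a := by
    obtain ⟨s, hs, has, h⟩ := hP a
    obtain ⟨ρ, hρ, hρs, hρa⟩ := exists_contDiff_eventuallyEq_id (hs.mem_nhds has)
    exact (h hρs hρ a).congr (hρa.mono fun y hy => by simp [hy])

instance : DiffeologicalVectorSpace (Nebula d →₀ ℝ) where
  smooth_add _ _ hP a := (hP.1 a).add (hP.2 a)
  smooth_smul _ _ hP a := (hP.2 a).smul hP.1.contDiff

theorem hasLocalRep_of_smoothFamily [FiniteDimensional ℝ E] {P : E → (Nebula d →₀ ℝ)}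
    (hP : SmoothFamily P) (a : E) : HasLocalRep P a := by
  have := HasLocalRep.comp (f := toEuclidean (E := E)) (a := a)
    (hP _ _ (toEuclidean (E := E)).symm.contDiff (toEuclidean a)) (toEuclidean (E := E)).contDiff
  simpa using this

theorem dSmooth_linearCombination {h : Nebula d → ℝ} (hh : SmoothFun h) :
    DSmooth (Finsupp.linearCombination ℝ h) := fun n P hP => by
  refine ContDiff.isPlot (contDiff_iff_contDiffAt.2 fun a => ?_)
  obtain ⟨N, c, g, hc, hg, hP⟩ := hP a
  have : ContDiff ℝ ∞ fun u => ∑ j, c j u * h (g j u) :=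
    ContDiff.sum fun j _ => (hc j).mul ((hg j).contDiff_fun hh)
  refine this.contDiffAt.congr_of_eventuallyEq (hP.mono fun u hu => ?_)
  simp [hu, map_sum]

end Nebula

instance {F : Type*} [AddCommGroup F] [Module ℝ F] [DiffeologicalSpace F]
    [DiffeologicalVectorSpace F] (S : Submodule ℝ F) : DiffeologicalVectorSpace S where
  smooth_add n p hp := DiffeologicalVectorSpace.smooth_add n (fun x => ((p x).1.1, (p x).2.1)) hp
  smooth_smul n p hp := DiffeologicalVectorSpace.smooth_smul n (fun x => ((p x).1, (p x).2.1)) hp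

/-! ### The principal bundle of a family of plots -/

theorem GSpaceOver.isTrivial_of_section {G : Type u} {B : Type v} [AddGroup G]
    [DiffeologicalSpace G] [DiffeologicalSpace B] {E : GSpaceOver.{u, v, w} G B} {σ : B → E.E}
    (hσ : DSmooth σ) (hproj : ∀ b, E.proj (σ b) = b) {δ : E.E → G} (hδ : DSmooth δ)
    (δσ : ∀ b, δ (σ b) = 0) (δact : ∀ e g, δ (E.act e g) = δ e + g)
    (hact : ∀ e, E.act (σ (E.proj e)) (δ e) = e) : E.IsTrivial := by
  refine ⟨⟨fun e => (E.proj e, δ e), fun q => E.act (σ q.1) q.2, hact, fun q => ?_⟩,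
    dSmooth_prodMk E.smooth_proj hδ,
    E.smooth_act.comp (dSmooth_prodMk (hσ.comp dSmooth_fst) dSmooth_snd), fun e => rfl,
    fun e g => Prod.ext (E.proj_act e g) (δact e g)⟩
  simp [E.proj_act, hproj, δact, δσ]

section

variable {K : Type u} {d : K → ℕ} {V : Type v}

/-- The combinations of points of a nebula whose image under `p` vanishes. -/
noncomputable abbrev nebulaKer (p : Nebula d → V) : Submodule ℝ (Nebula d →₀ ℝ) :=
  LinearMap.ker (Finsupp.lmapDomain ℝ ℝ p)

theorem mem_nebulaKer {p : Nebula d → V} {ξ : Nebula d →₀ ℝ} :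
    ξ ∈ nebulaKer p ↔ ξ.mapDomain p = 0 := Iff.rfl

variable [DiffeologicalSpace V]

/-- The bundle over `V` whose fibre over `v` consists of the combinations of points of a nebula
which `p` maps to the basis vector `v`. -/
noncomputable def nebulaBundle (p : Nebula d → V) : GSpaceOver (nebulaKer p) V where
  E := {q : V × (Nebula d →₀ ℝ) // q.2.mapDomain p = Finsupp.single q.1 1}
  proj q := q.1.1
  smooth_proj := dSmooth_fst.comp dSmooth_val
  act q w := ⟨(q.1.1, q.1.2 + w.1), by
    rw [Finsupp.mapDomain_add, q.2, mem_nebulaKer.1 w.2, add_zero]⟩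
  act_zero q := Subtype.ext (Prod.ext rfl (add_zero _))
  act_add q g h := Subtype.ext (Prod.ext rfl (add_assoc _ _ _).symm)
  smooth_act n q hq := ⟨hq.1.1, isPlot_add hq.1.2 hq.2⟩
  proj_act _ _ := rfl

variable {p : Nebula d → V}

theorem nebulaBundle_pullback_isTrivial {B : Type w} [DiffeologicalSpace B] (f : SmoothMap B V)
    {σ : B → (Nebula d →₀ ℝ)} (hσ : DSmooth σ)
    (h : ∀ b, (σ b).mapDomain p = Finsupp.single (f.1 b) 1) :
    ((nebulaBundle p).pullback f).IsTrivial := by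
  refine GSpaceOver.isTrivial_of_section (σ := fun b => ⟨(b, ⟨(f.1 b, σ b), h b⟩), rfl⟩)
    (fun n q hq => ⟨hq, f.2 n q hq, hσ n q hq⟩) (fun _ => rfl)
    (δ := fun e => ⟨e.1.2.1.2 - σ e.1.1, ?_⟩) ?_ ?_ ?_ ?_
  · rw [mem_nebulaKer, ← Finsupp.lmapDomain_apply ℝ ℝ, map_sub, Finsupp.lmapDomain_apply,
      Finsupp.lmapDomain_apply, e.1.2.2, h, e.2]
    exact sub_self _
  · intro n q hq
    have h1 : IsPlot fun x => (q x).1.2.1.2 := hq.2.2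
    have h2 := isPlot_add h1 (isPlot_smul (isPlot_const (x := (-1 : ℝ)))
      (hσ n (fun x => (q x).1.1) hq.1))
    change IsPlot fun x => (q x).1.2.1.2 - σ (q x).1.1
    simpa [sub_eq_add_neg] using h2
  · exact fun b => Subtype.ext (sub_self _)
  · exact fun e g => Subtype.ext (add_sub_right_comm _ _ _)
  · rintro ⟨⟨b, ⟨⟨v, ξ⟩, hξ⟩⟩, hb⟩
    have hb' : f.1 b = v := hb
    subst hb'
    exact Subtype.ext (Prod.ext rfl (Subtype.ext (Prod.ext rfl (add_sub_cancel _ _))))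

theorem nebulaBundle_pullback_restrict_isTrivial {B : Type w} [DiffeologicalSpace B]
    (f : SmoothMap B V) (O : Set B) {σ : O → (Nebula d →₀ ℝ)} (hσ : DSmooth σ)
    (h : ∀ b, (σ b).mapDomain p = Finsupp.single (f.1 b.1) 1) :
    (((nebulaBundle p).pullback f).restrict O).IsTrivial := by
  refine GSpaceOver.isTrivial_of_section
    (σ := fun b => ⟨⟨(b.1, ⟨(f.1 b.1, σ b), h b⟩), rfl⟩, b.2⟩)
    (fun n q hq => ⟨hq, f.2 n _ hq, hσ n q hq⟩) (fun _ => rfl)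
    (δ := fun e => ⟨e.1.1.2.1.2 - σ ⟨e.1.1.1, e.2⟩, ?_⟩) ?_ ?_ ?_ ?_
  · rw [mem_nebulaKer, ← Finsupp.lmapDomain_apply ℝ ℝ, map_sub, Finsupp.lmapDomain_apply,
      Finsupp.lmapDomain_apply, e.1.1.2.2, h, e.1.2]
    exact sub_self _
  · intro n q hq
    have h1 : IsPlot fun x => (q x).1.1.2.1.2 := hq.2.2
    have h2 := isPlot_add h1 (isPlot_smul (isPlot_const (x := (-1 : ℝ)))
      (hσ n (fun x => ⟨(q x).1.1.1, (q x).2⟩) hq.1))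
    change IsPlot fun x => (q x).1.1.2.1.2 - σ ⟨(q x).1.1.1, (q x).2⟩
    simpa [sub_eq_add_neg] using h2
  · exact fun b => Subtype.ext (sub_self _)
  · exact fun e g => Subtype.ext (add_sub_right_comm _ _ _)
  · rintro ⟨⟨⟨b, ⟨⟨v, ξ⟩, hξ⟩⟩, hb⟩, hO⟩
    have hb' : f.1 b = v := hb
    subst hb'
    exact Subtype.ext (Subtype.ext (Prod.ext rfl (Subtype.ext
      (Prod.ext rfl (add_sub_cancel _ _)))))

/-- A lift of a plot to the nebula is a section with a single term of coefficient one. Since only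
global plots are assumed to lift, the plot on `U` is first precomposed with a smooth map into `U`
that is the identity near `b`. -/
theorem nebulaBundle_isPrincipal
    (hp : ∀ (n : ℕ) (r : EuclideanSpace ℝ (Fin n) → V), IsPlot r →
      ∃ (k : K) (γ : EuclideanSpace ℝ (Fin n) → EuclideanSpace ℝ (Fin (d k))),
        ContDiff ℝ ∞ γ ∧ ∀ y, p (Nebula.mk k (γ y)) = r y) :
    (nebulaBundle p).IsPrincipal := by
  intro n U hU f b
  obtain ⟨ρ, hρ, hρU, hρb⟩ := exists_contDiff_eventuallyEq_id (hU.mem_nhds b.2)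
  have hr : IsPlot fun y => f.1 ⟨ρ y, hρU y⟩ := f.2 n (fun y => ⟨ρ y, hρU y⟩) hρ.isPlot
  obtain ⟨k, γ, hγ, hk⟩ := hp n _ hr
  refine ⟨{y | y.1 ∈ interior {y | ρ y = y}}, isOpen_iff_preimages_plots.2 fun m q hq => ?_,
    mem_interior_iff_mem_nhds.2 hρb, nebulaBundle_pullback_restrict_isTrivial f _
      (σ := fun o => Finsupp.single (Nebula.mk k (γ o.1.1)) 1) (fun m q hq a => ?_) fun o => ?_⟩
  · have hq' : IsPlot fun x => (q x).1 := hq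
    exact isOpen_interior.preimage hq'.contDiff.continuous
  · have hq' : IsPlot fun x => (q x).1.1 := hq
    exact Nebula.HasLocalRep.single ⟨k, _, hγ.comp hq'.contDiff, rfl⟩ a
  · rw [Finsupp.mapDomain_single, hk]
    have ho : ρ o.1.1 = o.1.1 := interior_subset (s := {y | ρ y = y}) o.2
    simp only [ho]

theorem exists_section_of_isTrivial (h : (nebulaBundle p).IsTrivial) :
    ∃ s : V → (Nebula d →₀ ℝ), DSmooth s ∧ ∀ v, (s v).mapDomain p = Finsupp.single v 1 := by
  obtain ⟨h, -, h2, h3, -⟩ := h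
  refine ⟨fun v => (h.symm (v, 0)).1.2, fun n q hq => ?_, fun v => ?_⟩
  · exact (h2 n (fun x => (q x, 0)) ⟨hq, isPlot_const⟩).2
  · have hv : (h.symm (v, 0)).1.1 = v := by
      have := h3 (h.symm (v, 0))
      rw [h.apply_symm_apply] at this
      exact this.symm
    rw [(h.symm (v, 0)).2, hv]

end

/-! ### Contractible spaces -/

/-- Contractibility makes precomposition with a constant map the identity on `[V, BG]`; by
naturality, pullback along that constant map then fixes the class of `E`. -/
theorem not_isClassifyingSpace {G V BG : Type u} [AddGroup G] [DiffeologicalSpace G]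
    [DiffeologicalAddGroup G] [DiffeologicalSpace V] [DiffeologicalSpace BG]
    (hV : SmoothlyContractible V) (E : PrincipalBundle G V) (hE : ¬ E.1.IsTrivial)
    (hconst : ∀ x : V, (E.1.pullback (⟨fun _ => x, dSmooth_const⟩ : SmoothMap V V)).IsTrivial) :
    ¬ IsClassifyingSpace G BG := by
  rintro ⟨θ, hθ⟩
  obtain ⟨x, F, hF, h0, h1⟩ := hV
  let e : Prin G V := Quotient.mk _ E
  obtain ⟨g, hg⟩ := Quot.exists_rep ((θ V).symm e)
  have hc : HomotopyClasses.precomp (⟨fun _ => x, dSmooth_const⟩ : SmoothMap V V)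
      ((θ V).symm e) = (θ V).symm e := by
    rw [← hg]
    exact (Quot.sound ⟨fun q => g.1 (F q), g.2.comp hF, fun y => congrArg g.1 (h0 y),
      fun y => congrArg g.1 (h1 y)⟩).symm
  have h := hθ V V ⟨fun _ => x, dSmooth_const⟩ ((θ V).symm e)
  rw [hc, Equiv.apply_symm_apply] at h
  have hiso : E.1.Iso (E.1.pullback ⟨fun _ => x, dSmooth_const⟩) := Quotient.exact h
  exact hE ((hconst x).of_iso hiso)

theorem smoothlyContractible (V : Type u) [AddCommGroup V] [Module ℝ V] [DiffeologicalSpace V]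
    [DiffeologicalVectorSpace V] : SmoothlyContractible V :=
  ⟨0, fun q => (1 - q.2) • q.1, fun _ _ hq =>
    isPlot_smul (contDiff_const.sub hq.2.contDiff).isPlot hq.1, fun x => by simp, fun x => by simp⟩

/-! ### Test functions on disjoint unions of Euclidean spaces -/

namespace Nebula

variable {K : Type u} {d : K → ℕ}

theorem smoothFun_coord (k : K) (φ : EuclideanSpace ℝ (Fin (d k)) → ℝ) (hφ : ContDiff ℝ ∞ φ) :
    SmoothFun fun x : Nebula d => φ (coord k x) := fun l => by
  by_cases h : l = k
  · subst h
    simpa using hφ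
  · simpa [coord_mk_of_ne h] using contDiff_const

/-- Vanishing near each point of `T`, not just on `T`, is what makes derivatives along curves
through these points vanish. It holds because the bump is supported in a compact ball of one
component, whose image is closed and misses `T`. -/
theorem exists_smoothFun_bump (z : Nebula d) {T : Set (Nebula d)} (hT : T.Finite) (hz : z ∉ T) :
    ∃ χ : Nebula d → ℝ, SmoothFun χ ∧ χ z = 1 ∧ ∀ t ∈ T, ∀ᶠ x in 𝓝 t, χ x = 0 := by
  classical
  obtain ⟨k, y⟩ := z
  change (mk k y) ∉ T at hz
  have hnhds : mk k ⁻¹' Tᶜ ∈ 𝓝 y :=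
    (continuous_mk k).continuousAt.preimage_mem_nhds (hT.isClosed.isOpen_compl.mem_nhds hz)
  obtain ⟨ε, hε, hεT⟩ := Metric.nhds_basis_closedBall.mem_iff.1 hnhds
  let β : ContDiffBump y := ⟨ε / 2, ε, by positivity, by linarith⟩
  refine ⟨fun x => if x.1 = k then β (coord k x) else 0, fun l => ?_, ?_, fun t ht => ?_⟩
  · by_cases h : l = k
    · subst h
      change ContDiff ℝ ∞ fun y' => if l = l then β (coord l (mk l y')) else 0
      simpa using β.contDiff
    · simpa [mk, h] using contDiff_const
  · change (if k = k then β (coord k (mk k y)) else 0) = 1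
    rw [if_pos rfl, coord_mk]
    exact β.one_of_mem_closedBall (Metric.mem_closedBall_self β.rIn_pos.le)
  · have hc : IsClosed (mk (d := d) k '' Metric.closedBall y ε) :=
      ((isCompact_closedBall y ε).image (continuous_mk k)).isClosed
    have htc : t ∉ mk k '' Metric.closedBall y ε := by
      rintro ⟨y', hy', rfl⟩
      exact hεT hy' ht
    filter_upwards [hc.isOpen_compl.mem_nhds htc] with x hx
    by_cases h : x.1 = k
    · rw [if_pos h]
      refine β.zero_of_le_dist (not_lt.1 fun hlt => hx ⟨coord k x, ?_, mk_coord h⟩)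
      exact Metric.mem_closedBall.2 hlt.le
    · exact if_neg h

theorem exists_linearCombination_ne_zero {ξ : Nebula d →₀ ℝ} (hξ : ξ ≠ 0) :
    ∃ h : Nebula d → ℝ, SmoothFun h ∧ Finsupp.linearCombination ℝ h ξ ≠ 0 := by
  classical
  obtain ⟨x, hx⟩ := Finsupp.ne_iff.1 hξ
  obtain ⟨χ, hχ, hχx, hχT⟩ := exists_smoothFun_bump x (T := ↑(ξ.support.erase x))
    (Finset.finite_toSet _) (by simp)
  refine ⟨χ, hχ, ?_⟩
  rw [Finsupp.linearCombination_apply, Finsupp.sum, Finset.sum_eq_single x]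
  · simpa [hχx] using hx
  · intro t ht htx
    rw [(hχT t (by simp [htx, Finsupp.mem_support_iff.1 ht])).self_of_nhds, smul_zero]
  · intro h
    simp [Finsupp.notMem_support_iff.1 h]

open Classical in
/-- The first order terms of a curve of combinations of points are detected by smooth functions. -/
theorem sum_smul_deriv_coord_eq_zero {J : Type*} [Fintype J] {c : J → ℝ → ℝ}
    {g : J → ℝ → Nebula d} (hc : ∀ j, ContDiff ℝ ∞ (c j)) (hg : ∀ j, SmoothMapTo (g j))
    (h : ∀ φ : Nebula d → ℝ, SmoothFun φ → deriv (fun t => ∑ j, c j t * φ (g j t)) 0 = 0)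
    (k : K) (y : EuclideanSpace ℝ (Fin (d k))) :
    ∑ j, (if g j 0 = mk k y then c j 0 • deriv (fun t => coord k (g j t)) 0 else 0) = 0 := by
  obtain ⟨χ, hχ, hχz, hχT⟩ := exists_smoothFun_bump (mk k y)
    (T := Set.range (fun j => g j 0) \ {mk k y})
    ((Set.finite_range _).subset Set.sdiff_subset) (by simp)
  refine ext_inner_left ℝ fun w => ?_
  rw [inner_sum, inner_zero_right]
  -- `ψ` vanishes at the point `y`, so the product rule discards the derivatives of the coefficients
  -- and of `χ`, leaving only the velocity of the points. The factor `χ` removes the terms based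
  -- elsewhere.
  let ψ : Nebula d → ℝ := fun x => inner ℝ w (coord k x - y)
  have hψ : SmoothFun ψ := smoothFun_coord k (fun y' => inner ℝ w (y' - y))
    (contDiff_const.inner ℝ (contDiff_id.sub contDiff_const))
  have hφ : SmoothFun fun x => χ x * ψ x := fun l => (hχ l).mul (hψ l)
  refine Eq.trans ?_ (h _ hφ)
  rw [deriv_fun_sum fun j _ => (((hc j).mul ((hg j).contDiff_fun hφ)).differentiable
    (by simp)).differentiableAt]
  refine Finset.sum_congr rfl fun j _ => ?_
  by_cases hj : g j 0 = mk k y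
  · have h1 : HasDerivAt (fun t => c j t * χ (g j t))
        (deriv (fun t => c j t * χ (g j t)) 0) 0 :=
      (((hc j).mul ((hg j).contDiff_fun hχ)).differentiable (by simp) 0).hasDerivAt
    have h2 : HasDerivAt (fun t => ψ (g j t))
        (inner ℝ w (deriv (fun t => coord k (g j t)) 0)) 0 := by
      have h3 := (((hg j).contDiff_coord k).differentiable (by simp) 0).hasDerivAt
      simpa using (hasDerivAt_const (0 : ℝ) w).inner ℝ (h3.sub_const (y))
    have h4 := (h1.mul h2).deriv
    rw [if_pos hj, inner_smul_right]
    simp only [hj, hχz, ψ, coord_mk, sub_self, inner_zero_right, mul_zero, mul_one, zero_add] at h4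
    rw [← h4]
    congr 1
    funext t
    simp [ψ, mul_assoc]
  · rw [if_neg hj, inner_zero_right]
    have h1 := (hg j).continuous.continuousAt.eventually (hχT (g j 0) ⟨⟨j, rfl⟩, hj⟩)
    rw [Filter.EventuallyEq.deriv_eq (f := fun _ => (0 : ℝ)) (h1.mono fun t ht => by simp [ht])]
    simp

end Nebula

/-! ### Spaces whose plots are locally finite-dimensional -/

theorem IsSubduction.surjective {X : Type u} {Y : Type v} [DiffeologicalSpace X]
    [DiffeologicalSpace Y] {f : X → Y} (hf : IsSubduction f) : Function.Surjective f := fun y => by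
  obtain ⟨U, -, h0, q, -, hq⟩ := hf.2 0 (fun _ => y) isPlot_const 0
  exact ⟨q ⟨0, h0⟩, hq _⟩

/-- Functionals on a finite-dimensional subspace extend to elements of any separating space of
functionals. -/
theorem exists_extension_of_separating {V : Type*} [AddCommGroup V] [Module ℝ V]
    (Φ : Submodule ℝ (Module.Dual ℝ V)) (hΦ : ∀ v ≠ 0, ∃ l ∈ Φ, l v ≠ 0) (T : Submodule ℝ V)
    [FiniteDimensional ℝ T] (l : Module.Dual ℝ T) : ∃ l' ∈ Φ, ∀ v : T, l' v = l v := by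
  have h : (Φ.map T.dualRestrict).dualCoannihilator = ⊥ := by
    rw [eq_bot_iff]
    intro v hv
    by_contra hne
    obtain ⟨l', hl', hl'v⟩ := hΦ v (by simpa using hne)
    exact hl'v ((Submodule.mem_dualCoannihilator _).1 hv _ (Submodule.mem_map_of_mem hl'))
  have h' : Φ.map T.dualRestrict = ⊤ := by
    rw [← Subspace.dualCoannihilator_dualAnnihilator_eq (W := Φ.map T.dualRestrict), h,
      Submodule.dualAnnihilator_bot]
  obtain ⟨l', hl', rfl⟩ : l ∈ Φ.map T.dualRestrict := h' ▸ Submodule.mem_top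
  exact ⟨l', hl', fun v => rfl⟩

section

variable (V : Type u) [AddCommGroup V] [Module ℝ V] [DiffeologicalSpace V]

/-- The smooth linear functionals. -/
def smoothDual : Submodule ℝ (Module.Dual ℝ V) where
  carrier := {l | DSmooth l}
  add_mem' hl hl' _ p hp := ((hl _ p hp).contDiff.add (hl' _ p hp).contDiff).isPlot
  zero_mem' := dSmooth_const
  smul_mem' _ _ hl _ p hp := (contDiff_const.mul (hl _ p hp).contDiff).isPlot

variable {V}

/-- A linear, possibly non-smooth, section `σ` of the subduction suffices. On a finite-dimensional
subspace the coordinates extend to smooth functionals, so along a plot `σ ∘ f` is locally a smooth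
combination of constant vectors. -/
theorem isProjective_of_locally_finiteDimensional
    (hsep : ∀ v : V, v ≠ 0 → ∃ l ∈ smoothDual V, l v ≠ 0)
    (hfin : ∀ (n : ℕ) (q : EuclideanSpace ℝ (Fin n) → V), IsPlot q → ∀ a,
      ∃ T : Submodule ℝ V, FiniteDimensional ℝ T ∧ ∀ᶠ y in 𝓝 a, q y ∈ T) : IsProjective V := by
  intro W₁ W₂ _ _ _ _ _ _ _ _ π f hπ hf
  obtain ⟨σ, hσ⟩ := π.exists_rightInverse_of_surjective (LinearMap.range_eq_top.2 hπ.surjective)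
  refine ⟨σ ∘ₗ f, fun n q hq => isPlot_of_locally fun a => ?_, fun x => LinearMap.congr_fun hσ _⟩
  obtain ⟨T, hT, hqT⟩ := hfin n q hq a
  let b := Module.finBasis ℝ T
  choose l hl hlb using fun i => exists_extension_of_separating _ hsep T (b.coord i)
  refine ⟨fun y => ∑ i, l i (q y) • σ (f (b i)),
    isPlot_sum _ fun i => isPlot_smul (hl i n q hq) isPlot_const, hqT.mono fun y hy => ?_⟩
  have h : ∑ i, l i (q y) • (b i : V) = q y := by
    have := congrArg Subtype.val (b.sum_repr ⟨q y, hy⟩)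
    simpa only [hlb _ ⟨q y, hy⟩, Module.Basis.coord_apply, Submodule.coe_sum,
      Submodule.coe_smul] using this
  simp only [Function.comp_apply, LinearMap.comp_apply]
  conv_lhs => rw [← h]
  simp [map_sum]

end

namespace Nebula

/-! ### Smooth maps into the free vector space -/

section

variable {K : Type u} {d : K → ℕ} {V : Type v} [AddCommGroup V] [Module ℝ V]
  [DiffeologicalSpace V] [DiffeologicalVectorSpace V]

open Classical in
/-- Along the homotopy `t • p`, the first order variation of `s` is of order `t`. -/
theorem exists_rep_norm_le {p : Nebula d → V} (hp : ∀ k, IsPlot fun y => p (mk k y))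
    {s : V → (Nebula d →₀ ℝ)} (hs : DSmooth s) (k : K) (x₀ : EuclideanSpace ℝ (Fin (d k))) :
    ∃ (N : ℕ) (C : Fin N → ℝ × EuclideanSpace ℝ (Fin (d k)) → ℝ)
      (Γ : Fin N → ℝ × EuclideanSpace ℝ (Fin (d k)) → Nebula d) (M : ℝ),
      (∀ j, ContDiff ℝ ∞ (C j)) ∧ (∀ j, SmoothMapTo (Γ j)) ∧
      ∀ᶠ u in 𝓝 (0, x₀), s (u.1 • p (mk k u.2)) = ∑ j, Finsupp.single (Γ j u) (C j u) ∧
        ∀ y w, ‖∑ j, if Γ j u = mk k y then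
          C j u • fderiv ℝ (fun u => coord k (Γ j u)) u (0, w) else 0‖ ≤ M * |u.1| * ‖w‖ := by
  have hr := smoothFamily_of_isPlot (hp k)
  have hP : SmoothFamily fun u : ℝ × EuclideanSpace ℝ (Fin (d k)) => s (u.1 • p (mk k u.2)) :=
    (SmoothFamily.smul contDiff_fst (hr.comp contDiff_snd)).dSmooth hs
  -- The same increment of `p`, now without the factor `t`; its local representation stays bounded
  -- as `t → 0` and supplies the constant `M`.
  have hQ : SmoothFamily fun
      q : (ℝ × EuclideanSpace ℝ (Fin (d k))) × EuclideanSpace ℝ (Fin (d k)) =>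
      s (q.1.1 • p (mk k q.1.2) + (p (mk k (q.1.2 + q.2)) - p (mk k q.1.2))) :=
    ((SmoothFamily.smul contDiff_fst.fst (hr.comp contDiff_fst.snd)).add
      ((hr.comp (contDiff_fst.snd.add contDiff_snd)).sub (hr.comp contDiff_fst.snd))).dSmooth hs
  obtain ⟨N, C, Γ, hC, hΓ, hP⟩ := hasLocalRep_of_smoothFamily hP (0, x₀)
  obtain ⟨N', B, Ψ, hB, hΨ, hQ⟩ := hasLocalRep_of_smoothFamily hQ ((0, x₀), 0)
  have hΨk := fun i => (hΨ i).contDiff_coord k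
  have hcont : Continuous fun u : ℝ × EuclideanSpace ℝ (Fin (d k)) =>
      ∑ i, |B i (u, 0)| * ‖fderiv ℝ (fun q => coord k (Ψ i q)) (u, 0)‖ := by
    refine continuous_finsetSum _ fun i _ => ?_
    have h1 : Continuous fun u : ℝ × EuclideanSpace ℝ (Fin (d k)) =>
        (u, (0 : EuclideanSpace ℝ (Fin (d k)))) := Continuous.prodMk_left _
    exact ((hB i).continuous.comp h1).abs.mul
      (((hΨk i).continuous_fderiv (by simp)).comp h1).norm
  -- Strict inequality at the base point persists nearby by continuity.
  obtain ⟨M, hM⟩ := exists_gt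
    (∑ i, |B i ((0, x₀), 0)| * ‖fderiv ℝ (fun q => coord k (Ψ i q)) ((0, x₀), 0)‖)
  refine ⟨N, C, Γ, M, hC, hΓ, ?_⟩
  have hQ' : ∀ᶠ u in 𝓝 ((0 : ℝ), x₀), ∀ᶠ q in 𝓝 (u, (0 : EuclideanSpace ℝ (Fin (d k)))), _ :=
    (Continuous.prodMk_left (0 : EuclideanSpace ℝ (Fin (d k)))).continuousAt.eventually
      hQ.eventually_nhds
  filter_upwards [hP.eventually_nhds, hQ', hcont.continuousAt.eventually (gt_mem_nhds hM)]
    with u hu hq hlt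
  refine ⟨hu.self_of_nhds, fun y w => ?_⟩
  have hline : ContDiff ℝ ∞ fun t : ℝ => u + t • ((0 : ℝ), w) :=
    contDiff_const.add (contDiff_id.smul contDiff_const)
  have hline' : ContDiff ℝ ∞ fun t : ℝ =>
      (u, (0 : EuclideanSpace ℝ (Fin (d k)))) + t • ((0 : ℝ × EuclideanSpace ℝ (Fin (d k))), w) :=
    contDiff_const.add (contDiff_id.smul contDiff_const)
  -- The two representations are combined with weights `1` and `-u.1`. By `deriv_smul_curve` no
  -- smooth function sees a first-order term of the difference, so the terms at each point of the
  -- nebula cancel.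
  have key := sum_smul_deriv_coord_eq_zero (J := Fin N ⊕ Fin N')
    (c := Sum.elim (fun j t => C j (u + t • (0, w))) fun i t => -u.1 * B i ((u, 0) + t • (0, w)))
    (g := Sum.elim (fun j t => Γ j (u + t • (0, w))) fun i t => Ψ i ((u, 0) + t • (0, w)))
    (Sum.rec (fun j => (hC j).comp hline) fun i => contDiff_const.mul ((hB i).comp hline'))
    (Sum.rec (fun j => (hΓ j).comp hline) fun i => (hΨ i).comp hline') ?_ k y
  · have hΓd : ∀ j, deriv (fun t : ℝ => coord k (Γ j (u + t • (0, w)))) 0 =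
        fderiv ℝ (fun u => coord k (Γ j u)) u (0, w) := fun j =>
      (((hΓ j).contDiff_coord k).differentiable (by simp) u).lineDeriv_eq_fderiv
    have hΨd : ∀ i, deriv (fun t : ℝ => coord k (Ψ i ((u, 0) + t • (0, w)))) 0 =
        fderiv ℝ (fun q => coord k (Ψ i q)) (u, 0) (0, w) := fun i =>
      ((hΨk i).differentiable (by simp) (u, 0)).lineDeriv_eq_fderiv
    simp only [Fintype.sum_sum_type, Sum.elim_inl, Sum.elim_inr, hΓd, hΨd, zero_smul,
      add_zero] at key
    rw [eq_neg_of_add_eq_zero_left key, norm_neg]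
    refine (norm_sum_le _ _).trans ?_
    calc _ ≤ ∑ i, |u.1| * ‖w‖ *
          (|B i (u, 0)| * ‖fderiv ℝ (fun q => coord k (Ψ i q)) (u, 0)‖) := ?_
      _ ≤ M * |u.1| * ‖w‖ := by
        rw [← Finset.mul_sum, show M * |u.1| * ‖w‖ = |u.1| * ‖w‖ * M by ring]
        exact mul_le_mul_of_nonneg_left hlt.le (by positivity)
    refine Finset.sum_le_sum fun i _ => ?_
    split_ifs
    · have h1 := (fderiv ℝ (fun q => coord k (Ψ i q)) (u, 0)).le_opNorm (0, w)
      have h2 : ‖((0 : ℝ × EuclideanSpace ℝ (Fin (d k))), w)‖ = ‖w‖ := by simp [Prod.norm_def]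
      rw [h2] at h1
      rw [norm_smul, Real.norm_eq_abs, abs_mul, abs_neg]
      calc _ ≤ |u.1| * |B i (u, 0)| *
            (‖fderiv ℝ (fun q => coord k (Ψ i q)) (u, 0)‖ * ‖w‖) := by gcongr
        _ = _ := by ring
    · simp only [norm_zero]
      positivity
  · intro φ hφ
    have hf : DSmooth fun v => Finsupp.linearCombination ℝ φ (s v) :=
      (dSmooth_linearCombination hφ).comp hs
    have hg : SmoothFamily fun t : ℝ => p (mk k (u.2 + t • w)) - p (mk k u.2) :=
      (hr.comp (contDiff_const.add (contDiff_id.smul contDiff_const))).sub (SmoothFamily.const _)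
    have hcurve := deriv_smul_curve hf (u.1 • p (mk k u.2)) hg (by simp) u.1
    have e1 : (fun t : ℝ => Finsupp.linearCombination ℝ φ (s (u.1 • p (mk k u.2) +
        u.1 • (p (mk k (u.2 + t • w)) - p (mk k u.2))))) =ᶠ[𝓝 0]
        fun t => ∑ j, C j (u + t • (0, w)) * φ (Γ j (u + t • (0, w))) := by
      have h0 : Filter.Tendsto (fun t : ℝ => u + t • ((0 : ℝ), w)) (𝓝 0) (𝓝 u) := by
        simpa using hline.continuous.tendsto 0
      filter_upwards [h0.eventually hu] with t ht
      rw [← smul_add, add_sub_cancel]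
      simp only [Prod.smul_mk, smul_zero, Prod.fst_add, add_zero, Prod.snd_add] at ht
      simp [ht, map_sum]
    have e2 : (fun t : ℝ => Finsupp.linearCombination ℝ φ (s (u.1 • p (mk k u.2) +
        (p (mk k (u.2 + t • w)) - p (mk k u.2))))) =ᶠ[𝓝 0]
        fun t => ∑ i, B i ((u, 0) + t • (0, w)) * φ (Ψ i ((u, 0) + t • (0, w))) := by
      have h0 : Filter.Tendsto (fun t : ℝ => (u, (0 : EuclideanSpace ℝ (Fin (d k)))) +
          t • ((0 : ℝ × EuclideanSpace ℝ (Fin (d k))), w)) (𝓝 0) (𝓝 (u, 0)) := by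
        simpa using hline'.continuous.tendsto 0
      filter_upwards [h0.eventually hq] with t ht
      simp only [Prod.smul_mk, smul_zero, Prod.fst_add, add_zero, Prod.snd_add, zero_add] at ht
      simp [ht, map_sum]
    rw [e1.deriv_eq, e2.deriv_eq] at hcurve
    have d1 : DifferentiableAt ℝ
        (fun t : ℝ => ∑ j, C j (u + t • (0, w)) * φ (Γ j (u + t • (0, w)))) 0 :=
      (ContDiff.sum fun j _ => ((hC j).comp hline).mul
        (((hΓ j).comp hline).contDiff_fun hφ)).differentiable (n := ∞) (by simp) _
    have d2 : DifferentiableAt ℝ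
        (fun t : ℝ => ∑ i, B i ((u, 0) + t • (0, w)) * φ (Ψ i ((u, 0) + t • (0, w)))) 0 :=
      (ContDiff.sum fun i _ => ((hB i).comp hline').mul
        (((hΨ i).comp hline').contDiff_fun hφ)).differentiable (n := ∞) (by simp) _
    simp only [Fintype.sum_sum_type, Sum.elim_inl, Sum.elim_inr, mul_assoc, ← Finset.mul_sum]
    rw [deriv_fun_add d1 (d2.const_mul _), deriv_const_mul _ d2, hcurve]
    ring

/-! ### Sections of the nebula bundle -/

/-- Points of a nebula at which `s` has a large coefficient along a curve lifting a ray are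
isolated. -/
theorem eventually_eq_of_frequently_large {p : Nebula d → V} (hp : ∀ k, IsPlot fun y => p (mk k y))
    {s : V → (Nebula d →₀ ℝ)} (hs : DSmooth s) (k : K) (x₀ : EuclideanSpace ℝ (Fin (d k))) {m : ℝ}
    (hm : 0 < m) :
    ∀ᶠ x in 𝓝 x₀, (∃ (v : V) (z : ℝ → EuclideanSpace ℝ (Fin (d k))), ContinuousAt z 0 ∧ z 0 = x ∧
      ∃ᶠ t in 𝓝[≠] 0, p (mk k (z t)) = t • v ∧ m ≤ |s (t • v) (mk k (z t))|) → x = x₀ := by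
  classical
  obtain ⟨N, C, Γ, M, hC, hΓ, hev⟩ := exists_rep_norm_le hp hs k x₀
  let D := fun j u => fderiv ℝ (fun u => coord k (Γ j u)) u
  have hD : ∀ j, Continuous (D j) := fun j =>
    ((hΓ j).contDiff_coord k).continuous_fderiv (by simp)
  -- The set of indices `j` whose point is `mk k y` is not stable under limits, and terms that merge
  -- in the limit may cancel. Fixing the index set `J` yields closed conditions, and there are only
  -- finitely many choices of `J`.
  let S : Finset (Fin N) →
      Set ((ℝ × EuclideanSpace ℝ (Fin (d k))) × EuclideanSpace ℝ (Fin (d k))) := fun J =>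
    {q | (∀ j ∈ J, Γ j q.1 = mk k q.2) ∧ m ≤ |∑ j ∈ J, C j q.1| ∧
      ∀ w, ‖∑ j ∈ J, C j q.1 • D j q.1 (0, w)‖ ≤ M * |q.1.1| * ‖w‖}
  have hS : ∀ J, IsClosed (S J) := fun J => by
    have hCc := fun j => (hC j).continuous
    have hΓc := fun j => (hΓ j).continuous
    have h1 : IsClosed {q : (ℝ × EuclideanSpace ℝ (Fin (d k))) × EuclideanSpace ℝ (Fin (d k)) |
        ∀ j ∈ J, Γ j q.1 = mk k q.2} := by
      simp only [Set.ofPred_forall]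
      exact isClosed_biInter fun j _ =>
        isClosed_eq ((hΓc j).comp continuous_fst) ((continuous_mk k).comp continuous_snd)
    have h2 : IsClosed {q : (ℝ × EuclideanSpace ℝ (Fin (d k))) × EuclideanSpace ℝ (Fin (d k)) |
        ∀ w, ‖∑ j ∈ J, C j q.1 • D j q.1 (0, w)‖ ≤ M * |q.1.1| * ‖w‖} := by
      simp only [Set.ofPred_forall]
      exact isClosed_iInter fun w => isClosed_le (by fun_prop) (by fun_prop)
    exact h1.inter (IsClosed.inter (isClosed_le continuous_const (continuous_finsetSum _ fun j _ =>
      (hCc j).comp continuous_fst).abs) h2)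
  have hlarge : ∀ u : ℝ × EuclideanSpace ℝ (Fin (d k)),
      (s (u.1 • p (mk k u.2)) = ∑ j, Finsupp.single (Γ j u) (C j u) ∧
        ∀ y w, ‖∑ j, if Γ j u = mk k y then
          C j u • fderiv ℝ (fun u => coord k (Γ j u)) u (0, w) else 0‖ ≤ M * |u.1| * ‖w‖) →
      ∀ y, m ≤ |s (u.1 • p (mk k u.2)) (mk k y)| → ∃ J, (u, y) ∈ S J := by
    rintro u ⟨h1, h2⟩ y h3
    refine ⟨Finset.univ.filter fun j => Γ j u = mk k y, by simp, ?_, fun w => ?_⟩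
    · rw [h1, Finsupp.finsetSum_apply] at h3
      simpa [Finsupp.single_apply, Finset.sum_filter] using h3
    · rw [Finset.sum_filter]
      exact h2 y w
  have hlim : ∀ᶠ x in 𝓝 x₀, (∃ (v : V) (z : ℝ → EuclideanSpace ℝ (Fin (d k))),
      ContinuousAt z 0 ∧ z 0 = x ∧
      ∃ᶠ t in 𝓝[≠] 0, p (mk k (z t)) = t • v ∧ m ≤ |s (t • v) (mk k (z t))|) →
      ∃ J, ((0, x), x) ∈ S J := by
    have h0 : Continuous fun x : EuclideanSpace ℝ (Fin (d k)) => ((0 : ℝ), x) :=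
      Continuous.prodMk_right 0
    filter_upwards [h0.continuousAt.eventually hev.eventually_nhds]
    rintro _ hev ⟨v, z, hz, rfl, hfreq⟩
    have hzc : Filter.Tendsto z (𝓝[≠] 0) (𝓝 (z 0)) := hz.tendsto.mono_left nhdsWithin_le_nhds
    have hz0 : Filter.Tendsto (fun t => ((0 : ℝ), z t)) (𝓝[≠] 0) (𝓝 (0, z 0)) :=
      tendsto_const_nhds.prodMk_nhds hzc
    -- Two parameters on the same ray: `l • v = (l / e) • p (z e)`, so the coefficient at `z l` is
    -- read off from the representation at `(l / e, z e)`. First `l → 0` with `e` fixed, then `e →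
    -- 0`; a single `J` recurs in each limit.
    have houter : ∃ᶠ e in 𝓝[≠] (0 : ℝ), ∃ J, ((0, z e), z 0) ∈ S J := by
      refine (hfreq.and_eventually ((hz0.eventually hev.eventually_nhds).and
        eventually_mem_nhdsWithin)).mono ?_
      rintro e ⟨⟨he, -⟩, heev, hne⟩
      have hle : Filter.Tendsto (fun l : ℝ => (l / e, z e)) (𝓝[≠] 0) (𝓝 (0, z e)) := by
        refine Filter.Tendsto.prodMk_nhds ?_ tendsto_const_nhds
        have : ContinuousAt (fun l : ℝ => l / e) 0 := by fun_prop
        simpa using this.tendsto.mono_left nhdsWithin_le_nhds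
      have hinner : ∃ᶠ l in 𝓝[≠] (0 : ℝ), ∃ J, ((l / e, z e), z l) ∈ S J := by
        refine (hfreq.and_eventually (hle.eventually heev)).mono ?_
        rintro l ⟨⟨-, hl⟩, hlev⟩
        refine hlarge _ hlev _ ?_
        simp only [he, smul_smul, div_mul_cancel₀ l hne]
        exact hl
      obtain ⟨J, hJ⟩ := Filter.frequently_exists.1 hinner
      exact ⟨J, (hS J).mem_of_frequently_of_tendsto hJ (hle.prodMk_nhds hzc)⟩
    obtain ⟨J, hJ⟩ := Filter.frequently_exists.1 houter
    exact ⟨J, (hS J).mem_of_frequently_of_tendsto hJ (hz0.prodMk_nhds tendsto_const_nhds)⟩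
  have hisol : ∀ J, ∀ᶠ x in 𝓝 x₀, ((0, x), x) ∈ S J → x = x₀ := by
    intro J
    by_cases hJ : ((0, x₀), x₀) ∈ S J
    · obtain ⟨hJ1, hJ2, hJ3⟩ := hJ
      have hc : ∑ j ∈ J, C j (0, x₀) ≠ 0 := fun h => by
        simp only [h, abs_zero] at hJ2
        exact hm.not_ge hJ2
      -- `G` vanishes wherever all terms of `J` sit at `x`. At `t = 0` the bound kills the
      -- derivative of its first sum, so its derivative at `x₀` is a nonzero multiple of the
      -- identity and `x₀` is an isolated zero.
      let G : EuclideanSpace ℝ (Fin (d k)) → EuclideanSpace ℝ (Fin (d k)) := fun x =>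
        ∑ j ∈ J, C j (0, x₀) • coord k (Γ j (0, x)) - (∑ j ∈ J, C j (0, x₀)) • x
      have hG : HasFDerivAt G (-(∑ j ∈ J, C j (0, x₀)) •
          ContinuousLinearMap.id ℝ (EuclideanSpace ℝ (Fin (d k)))) x₀ := by
        have h1 : ∀ j, HasFDerivAt (fun x => coord k (Γ j (0, x)))
            ((D j (0, x₀)).comp (ContinuousLinearMap.inr ℝ ℝ _)) x₀ := fun j =>
          HasFDerivAt.comp (g := fun u => coord k (Γ j u)) (f := fun x => ((0 : ℝ), x)) x₀
            (((hΓ j).contDiff_coord k).differentiable (by simp) (0, x₀)).hasFDerivAt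
            (hasFDerivAt_prodMk_right 0 x₀)
        have h2 := (HasFDerivAt.fun_sum fun j (_ : j ∈ J) =>
          (h1 j).const_smul (C j (0, x₀))).sub
            ((hasFDerivAt_id x₀).const_smul (∑ j ∈ J, C j (0, x₀)))
        refine h2.congr_fderiv ?_
        ext1 w
        have h3 : ∑ j ∈ J, C j (0, x₀) • D j (0, x₀) (0, w) = 0 := by
          simpa using hJ3 w
        simp [h3]
      have hne := hG.eventually_ne (c := 0) ⟨‖(∑ j ∈ J, C j (0, x₀))‖₊⁻¹,
        AddMonoidHomClass.antilipschitz_of_bound _ fun x => by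
          have : ‖∑ j ∈ J, C j (0, x₀)‖ ≠ 0 := norm_ne_zero_iff.2 hc
          simp only [smul_apply, ContinuousLinearMap.id_apply, norm_smul,
            norm_neg, NNReal.coe_inv, coe_nnnorm]
          rw [inv_mul_cancel_left₀ this]⟩
      filter_upwards [eventually_nhdsWithin_iff.1 hne] with x hx
      rintro ⟨h1, -, -⟩
      by_contra hxx
      refine hx hxx ?_
      simp only [G]
      rw [Finset.sum_smul, sub_eq_zero]
      exact Finset.sum_congr rfl fun j hj => by rw [h1 j hj, coord_mk]
    · have hcont : Continuous fun x : EuclideanSpace ℝ (Fin (d k)) => (((0 : ℝ), x), x) := by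
        fun_prop
      filter_upwards [hcont.continuousAt.eventually ((hS J).isOpen_compl.mem_nhds hJ)] with x hx h
      exact absurd h hx
  filter_upwards [hlim, Filter.eventually_all.2 hisol] with x h1 h2 h3
  obtain ⟨J, hJ⟩ := h1 h3
  exact h2 J hJ

/-- At most `N` points carry `ξ`, and the coefficients over `w` sum to one; if all were below `1 /
(N + 1)`, the sum would be at most `N / (N + 1)`. The bound depends only on `N`, hence is uniform
along a local representation. -/
theorem exists_large_coefficient {X W : Type*} {p : X → W} {N : ℕ} {g : Fin N → X}
    {c : Fin N → ℝ} {ξ : X →₀ ℝ} (hξ : ξ = ∑ j, Finsupp.single (g j) (c j)) {w : W}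
    (h : ξ.mapDomain p = Finsupp.single w 1) :
    ∃ j, p (g j) = w ∧ ((N : ℝ) + 1)⁻¹ ≤ |ξ (g j)| := by
  classical
  by_contra! hlt
  have hN : (0 : ℝ) < (N : ℝ) + 1 := by positivity
  have hsupp : ξ.support ⊆ Finset.univ.image g := fun x hx => by
    by_contra hxg
    refine Finsupp.mem_support_iff.1 hx ?_
    rw [hξ, Finsupp.finsetSum_apply]
    refine Finset.sum_eq_zero fun j _ => Finsupp.single_eq_of_ne fun hj => hxg ?_
    exact Finset.mem_image.2 ⟨j, Finset.mem_univ _, hj.symm⟩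
  have hcard : ξ.support.card ≤ N := by
    simpa using (Finset.card_le_card hsupp).trans Finset.card_image_le
  have hsum : ∑ x ∈ ξ.support, (if p x = w then ξ x else 0) = 1 := by
    have := DFunLike.congr_fun h w
    simpa [Finsupp.mapDomain, Finsupp.sum_apply, Finsupp.sum, Finsupp.single_apply] using this
  have hle : ∑ x ∈ ξ.support, (if p x = w then ξ x else 0) ≤
      ξ.support.card • ((N : ℝ) + 1)⁻¹ := by
    refine Finset.sum_le_card_nsmul _ _ _ fun x hx => ?_
    obtain ⟨j, -, rfl⟩ := Finset.mem_image.1 (hsupp hx)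
    split_ifs with hj
    · exact (le_abs_self _).trans (hlt j hj).le
    · positivity
  rw [hsum, nsmul_eq_mul, ← div_eq_mul_inv, le_div_iff₀ hN, one_mul] at hle
  have : (ξ.support.card : ℝ) ≤ N := by exact_mod_cast hcard
  linarith

/-- If the nebula bundle has a smooth section, then every plot is locally contained in a
finite-dimensional subspace. -/
theorem exists_finiteDimensional_of_section {p : Nebula d → V}
    (hp : ∀ k, IsPlot fun y => p (mk k y)) {s : V → (Nebula d →₀ ℝ)} (hs : DSmooth s)
    (hsp : ∀ v, (s v).mapDomain p = Finsupp.single v 1)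
    (hsep : ∀ v : V, v ≠ 0 → ∃ l ∈ smoothDual V, l v ≠ 0)
    {n : ℕ} {q : EuclideanSpace ℝ (Fin n) → V} (hq : IsPlot q) (a : EuclideanSpace ℝ (Fin n)) :
    ∃ T : Submodule ℝ V, FiniteDimensional ℝ T ∧ ∀ᶠ y in 𝓝 a, q y ∈ T := by
  have hP : SmoothFamily fun u : ℝ × EuclideanSpace ℝ (Fin n) => s (u.1 • q u.2) :=
    (SmoothFamily.smul contDiff_fst ((smoothFamily_of_isPlot hq).comp contDiff_snd)).dSmooth hs
  obtain ⟨N, c, g, -, hg, hev⟩ := hasLocalRep_of_smoothFamily hP (0, a)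
  choose k γ hγ hgγ using hg
  let R : ∀ i, EuclideanSpace ℝ (Fin (d (k i))) →ₗ[ℝ] smoothDual V → ℝ := fun i =>
    LinearMap.pi fun l => (fderiv ℝ (fun y => l.1 (p (mk (k i) y))) (γ i (0, a))).toLinearMap
  -- `p` has no derivative with values in `V`, so derivatives are taken after embedding `V` into the
  -- functions on its smooth dual. There the differentials at the finitely many points `γ i (0, a)`
  -- span a finite-dimensional space.
  let ev : V →ₗ[ℝ] smoothDual V → ℝ := LinearMap.pi fun l => l.1
  have hev_inj : Function.Injective ev := by
    refine (injective_iff_map_eq_zero ev).2 fun v hv => ?_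
    by_contra hne
    obtain ⟨l, hl, hlv⟩ := hsep v hne
    exact hlv (congrFun hv ⟨l, hl⟩)
  let S : Submodule ℝ (smoothDual V → ℝ) := ⨆ i, LinearMap.range (R i)
  refine ⟨S.comap ev, ?_, ?_⟩
  · have hmaps : ∀ v ∈ S.comap ev, ev v ∈ S := fun v hv => hv
    refine FiniteDimensional.of_injective (ev.restrict hmaps) fun v v' h => ?_
    exact Subtype.ext (hev_inj (congrArg Subtype.val h))
  have h0 : Continuous fun y : EuclideanSpace ℝ (Fin n) => ((0 : ℝ), y) :=
    Continuous.prodMk_right 0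
  have hisol : ∀ i, ∀ᶠ y in 𝓝 a, (∃ (v : V) (z : ℝ → EuclideanSpace ℝ (Fin (d (k i)))),
      ContinuousAt z 0 ∧ z 0 = γ i (0, y) ∧ ∃ᶠ t in 𝓝[≠] 0, p (mk (k i) (z t)) = t • v ∧
        ((N : ℝ) + 1)⁻¹ ≤ |s (t • v) (mk (k i) (z t))|) → γ i (0, y) = γ i (0, a) := fun i =>
    ((hγ i).continuous.comp h0).continuousAt.eventually
      (eventually_eq_of_frequently_large hp hs (k i) (γ i (0, a)) (by positivity))
  filter_upwards [h0.continuousAt.eventually hev.eventually_nhds, Filter.eventually_all.2 hisol]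
    with y hy hiso
  have hline : ContDiff ℝ ∞ fun t : ℝ => (t, y) := contDiff_id.prodMk contDiff_const
  have hfreq : ∃ᶠ t in 𝓝[≠] (0 : ℝ), ∃ i, p (mk (k i) (γ i (t, y))) = t • q y ∧
      ((N : ℝ) + 1)⁻¹ ≤ |s (t • q y) (mk (k i) (γ i (t, y)))| := by
    refine Filter.Eventually.frequently ?_
    have h1 : Filter.Tendsto (fun t : ℝ => (t, y)) (𝓝[≠] 0) (𝓝 (0, y)) :=
      (hline.continuous.tendsto 0).mono_left nhdsWithin_le_nhds
    filter_upwards [h1.eventually hy] with t ht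
    simpa only [hgγ] using exists_large_coefficient ht (hsp (t • q y))
  obtain ⟨i, hi⟩ := Filter.frequently_exists.1 hfreq
  have hγy : ContDiff ℝ ∞ fun t : ℝ => γ i (t, y) := (hγ i).comp hline
  have hfix : γ i (0, y) = γ i (0, a) :=
    hiso i ⟨q y, fun t => γ i (t, y), hγy.continuous.continuousAt, rfl, hi⟩
  refine Submodule.mem_iSup_of_mem i ⟨deriv (fun t => γ i (t, y)) 0, funext fun l => ?_⟩
  have hl : ContDiff ℝ ∞ fun y => l.1 (p (mk (k i) y)) := (l.2 _ _ (hp (k i))).contDiff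
  have h1 : HasDerivAt (fun t : ℝ => l.1 (p (mk (k i) (γ i (t, y)))))
      (fderiv ℝ (fun y => l.1 (p (mk (k i) y))) (γ i (0, a)) (deriv (fun t => γ i (t, y)) 0)) 0 :=
    HasFDerivAt.comp_hasDerivAt (l := fun y => l.1 (p (mk (k i) y)))
      (f := fun t : ℝ => γ i (t, y)) 0
      (by simpa only [hfix] using (hl.differentiable (by simp) _).hasFDerivAt)
      (hγy.differentiable (by simp) 0).hasDerivAt
  have h2 : HasDerivAt (fun t : ℝ => l.1 (p (mk (k i) (γ i (t, y)))) - t * l.1 (q y)) _ 0 :=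
    h1.sub ((hasDerivAt_id 0).mul_const (l.1 (q y)))
  -- Otherwise `l (p (z t)) - t * l (q y)` has nonzero derivative at `0` and so no zeros at small `t
  -- ≠ 0`, whereas `p (z t) = t • q y` holds for arbitrarily small `t`.
  by_contra hne
  refine hi ?_
  filter_upwards [h2.eventually_ne (c := 0) (by
    rw [one_mul]
    exact sub_ne_zero.2 hne)] with t ht ht'
  refine ht ?_
  rw [ht'.1, map_smul, smul_eq_mul, sub_self]

/-- The section is injective because `p_*` recovers `δ_v` from `s v`; a smooth function on the
nebula that separates `s v` from `s 0` then separates `v` from `0`. -/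
theorem exists_smoothDual_ne_zero {p : Nebula d → V} {s : V → (Nebula d →₀ ℝ)} (hs : DSmooth s)
    (hsp : ∀ v, (s v).mapDomain p = Finsupp.single v 1) {v : V} (hv : v ≠ 0) :
    ∃ l ∈ smoothDual V, l v ≠ 0 := by
  have hne : s v - s 0 ≠ 0 := fun h => hv <| by
    have := hsp v
    rw [sub_eq_zero.1 h, hsp 0] at this
    exact (Finsupp.single_left_injective one_ne_zero this).symm
  obtain ⟨h, hh, hne⟩ := exists_linearCombination_ne_zero hne
  rw [map_sub, sub_ne_zero] at hne
  obtain ⟨l, hl, hlv⟩ := exists_smooth_functional ((dSmooth_linearCombination hh).comp hs) hne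
  exact ⟨l, hl, hlv⟩

end

end Nebula

/-- The plots of a diffeological space. -/
abbrev PlotIndex (V : Type u) [DiffeologicalSpace V] : Type u :=
  Σ n : ℕ, {r : EuclideanSpace ℝ (Fin n) → V // IsPlot r}

/-- The evaluation of all plots of `V`. -/
def plotEval (V : Type u) [DiffeologicalSpace V] (x : Nebula (Sigma.fst : PlotIndex V → ℕ)) : V :=
  x.1.2.1 x.2

end DiffBundle

theorem mainTheorem11 (V : Type u) [AddCommGroup V] [Module ℝ V] [DiffeologicalSpace V]
    [DiffBundle.DiffeologicalVectorSpace V] (hV : ¬ DiffBundle.IsProjective V) :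
    DiffBundle.SmoothlyContractible V ∧
    ∃ (W : Type u) (_ : AddCommGroup W) (_ : Module ℝ W) (_ : DiffeologicalSpace W)
      (_ : DiffBundle.DiffeologicalVectorSpace W),
      (∃ E : DiffBundle.PrincipalBundle W V, ¬ E.1.IsTrivial) ∧
      ¬ ∃ (BW : Type u) (_ : DiffeologicalSpace BW), DiffBundle.IsClassifyingSpace W BW := by
  have hnontriv : ¬ (DiffBundle.nebulaBundle (DiffBundle.plotEval V)).IsTrivial := fun h => by
    obtain ⟨s, hs, hsp⟩ := DiffBundle.exists_section_of_isTrivial h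
    have hsep : ∀ v : V, v ≠ 0 → ∃ l ∈ DiffBundle.smoothDual V, l v ≠ 0 := fun v hv =>
      DiffBundle.Nebula.exists_smoothDual_ne_zero hs hsp hv
    exact hV (DiffBundle.isProjective_of_locally_finiteDimensional hsep fun n q hq a =>
      DiffBundle.Nebula.exists_finiteDimensional_of_section (fun k => k.2.2) hs hsp hsep hq a)
  have hprin : (DiffBundle.nebulaBundle (DiffBundle.plotEval V)).IsPrincipal :=
    DiffBundle.nebulaBundle_isPrincipal fun n r hr =>
      ⟨⟨n, r, hr⟩, id, contDiff_id, fun _ => rfl⟩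
  refine ⟨DiffBundle.smoothlyContractible V, DiffBundle.nebulaKer (DiffBundle.plotEval V),
    inferInstance, inferInstance, inferInstance, inferInstance, ⟨⟨_, hprin⟩, hnontriv⟩, ?_⟩
  rintro ⟨BW, _, hBW⟩
  refine DiffBundle.not_isClassifyingSpace (DiffBundle.smoothlyContractible V) ⟨_, hprin⟩ hnontriv
    (fun x => ?_) hBW
  -- The point `x` is itself a plot of dimension zero, which gives a constant section of the
  -- pullback along the constant map.
  refine DiffBundle.nebulaBundle_pullback_isTrivial _ (σ := fun _ => Finsupp.single
    (DiffBundle.Nebula.mk ⟨0, fun _ => x, isPlot_const⟩ 0) 1) dSmooth_const fun _ => ?_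
  rw [Finsupp.mapDomain_single]
  rfl
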